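/- **Setting.** Let $d,m\ge 1$, $n\ge 0$ be integers, let $\Gamma$ be a bipartite graph between $n$ points and $m$ views with edge set $E\subseteq\{1,\dots,n\}\times\{1,\dots,m\}$, and for $(k,i)\in E$ let $x_{k,i}\in\mathbb R^d$ be the local coordinates of point $k$ in view $i$. Put $e_{ki}=e_k-e_{n+i}\in\mathbb R^{n+m}$ and $$\mathcal L_\Gamma=\sum_{(k,i)\in E}e_{ki}e_{ki}^T,\qquad B=\sum_{(k,i)\in E}(e_i\otimes I_d)x_{k,i}e_{ki}^T,\qquad D=\sum_{(k,i)\in E}(e_i\otimes I_d)x_{k,i}x_{k,i}^T(e_i\otimes I_d)^T,$$ and let $C=D-B\mathcal L_\Gamma^\dagger B^T\in\mathbb R^{md\times md}$, where $\dagger$ is the Moore–Penrose pseudoinverse. An element $S=[S_i]_1^m$ of $\mathbb O(d)^m$ is regarded as an $md\times d$ matrix of stacked blocks; let $F(S)=\mathrm{Tr}(CSS^T)$. The group $\mathbb O(d)$ acts on $\mathbb O(d)^m$ by $S\mapsto SQ=[S_iQ]_1^m$; let $\pi:\mathbb O(d)^m\to\mathbb O(d)^m/\mathbb O(d)$ be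 the projection and $\widetilde F$ the induced function, $\widetilde F(\pi(S))=F(S)$. Give $\mathbb O(d)^m$ the metric $g(Z,W)=\mathrm{Tr}(Z^TW)$ and the quotient the metric $\widetilde g$ for which $\pi$ is a Riemannian submersion. The vertical space at $S$ is $\mathcal V_S=\{[S_i\Omega]_1^m:\Omega\in\mathrm{Skew}(d)\}$, and the horizontal space $\mathcal H_S$ is its $g$-orthogonal complement in $T_S\mathbb O(d)^m$; every $Z\in\mathcal H_S$ is the horizontal lift of a unique tangent vector $\widetilde Z$ of the quotient at $\pi(S)$. $\mathrm{Hess}\,\widetilde F$ is the Riemannian Hessian with respect to $\widetilde g$. A *non-degenerate local minimum* is a local minimum at which $\mathrm{Hess}\,\widetilde F$ is nonsingular. Let $C(S)$ be the $md\times md$ matrix with $d\times d$ blocks $C(S)_{ij}=S_i^TC_{ij}S_j$, let $\widehat C(S)$ be the block diagonal matrix with $i$th block $\sum_{j=1}^m C(S)_{ij}$, and let $L(S)=C(S)-\widehat C(S)$. For $\omega=[\omega_i]_1^m$ with $\omega_i\in\mathbb R^{d(d-1)/2}$ let $\Omega_i\in\mathrm{Skew}(d)$ be the skew-symmetric matrix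 whose strictly lower triangular entries are $\omega_i$, let $\Omega=[\Omega_i]_1^m$, and let $J$ be the matrix with $\mathrm{vec}(\Omega)=J\omega$ for all $\omega$ (column-major vectorization). Put $\mathbb L(S)=J^T(I_d\otimes L(S))J$, a square matrix of size $md(d-1)/2$, so that $\omega^T\mathbb L(S)\omega=\mathrm{Tr}(\Omega^TL(S)\Omega)$. **Theorem.** Let $S\in\mathbb O(d)^m$ be such that $\pi(S)$ is a critical point of $\widetilde F$. The following are equivalent. 1. $\pi(S)$ is a non-degenerate local minimum of $\widetilde F$. 2. $\widetilde g(\mathrm{Hess}\,\widetilde F(\pi(S))[\widetilde Z],\widetilde Z)>0$ for every tangent vector $\widetilde Z$ with horizontal lift $Z\in\mathcal H_S$, $Z\neq0$. 3. $\mathrm{Tr}(\Omega^TL(S)\Omega)>0$ for every $\Omega=[\Omega_i]_1^m\ne0$ with $\Omega_i\in\mathrm{Skew}(d)$ and $\sum_{i=1}^m\Omega_i=0$. 4. $\mathrm{Tr}(\Omega^TL(S)\Omega)>0$ for every $\Omega=[\Omega_i]_1^m$ with $\Omega_i\in\mathrm{Skew}(d)$ not all equal. 5. $\omega^T\mathbb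 L(S)\omega>0$ for every $\omega=[\omega_i]_1^m$ with $\omega_i\in\mathbb R^{d(d-1)/2}$ not all equal. 6. $\mathbb L(S)$ is symmetric positive semidefinite and $\mathrm{rank}\,\mathbb L(S)=(m-1)d(d-1)/2$. 7. $\mathbb L(S)$ is symmetric and its $(d(d-1)/2+1)$th smallest eigenvalue (counted with multiplicity) is positive; the requirement on the eigenvalue is void if $\mathbb L(S)$ has no more than $d(d-1)/2$ eigenvalues, i.e. if $m=1$ or $d=1$. -/

import Mathlib

open Matrix
open scoped Kronecker

noncomputable section

namespace Procrustes

/-! ### The Moore-Penrose pseudoinverse -/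

/-- `X` satisfies the four Penrose equations for the real matrix `A`. -/
def IsPinv {ι κ : Type*} [Fintype ι] [Fintype κ] (A : Matrix ι κ ℝ) (X : Matrix κ ι ℝ) : Prop :=
  A * X * A = A ∧ X * A * X = X ∧ (A * X)ᵀ = A * X ∧ (X * A)ᵀ = X * A

open Classical in
/-- The Moore-Penrose pseudoinverse: the solution of the Penrose equations. -/
def pinv {ι κ : Type*} [Fintype ι] [Fintype κ] (A : Matrix ι κ ℝ) : Matrix κ ι ℝ :=
  if h : ∃ X, IsPinv A X then h.choose else 0

theorem IsPinv.unique {ι κ : Type*} [Fintype ι] [Fintype κ] {A : Matrix ι κ ℝ}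
    {X Y : Matrix κ ι ℝ} (hX : IsPinv A X) (hY : IsPinv A Y) : X = Y := by
  obtain ⟨x1, x2, x3, x4⟩ := hX
  obtain ⟨y1, y2, y3, y4⟩ := hY
  have e1 : A * X = A * Y := by
    calc A * X = (A * X)ᵀ := x3.symm
      _ = ((A * Y) * (A * X))ᵀ := by rw [← Matrix.mul_assoc, y1]
      _ = (A * X)ᵀ * (A * Y)ᵀ := Matrix.transpose_mul _ _
      _ = A * X * (A * Y) := by rw [x3, y3]
      _ = A * Y := by rw [← Matrix.mul_assoc, x1]
  have e2 : X * A = Y * A := by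
    calc X * A = (X * A)ᵀ := x4.symm
      _ = ((X * A) * (Y * A))ᵀ := by
          rw [Matrix.mul_assoc X A, ← Matrix.mul_assoc A Y A, y1]
      _ = (Y * A)ᵀ * (X * A)ᵀ := Matrix.transpose_mul _ _
      _ = Y * A * (X * A) := by rw [x4, y4]
      _ = Y * A := by rw [Matrix.mul_assoc Y A, ← Matrix.mul_assoc A X A, x1]
  calc X = X * A * X := x2.symm
    _ = Y * (A * X) := by rw [e2, Matrix.mul_assoc]
    _ = Y * A * Y := by rw [e1, Matrix.mul_assoc]
    _ = Y := y2

/-- A real symmetric matrix has a pseudoinverse. -/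
theorem exists_isPinv {ι : Type*} [Fintype ι] {A : Matrix ι ι ℝ} (hA : Aᵀ = A) :
    ∃ X, IsPinv A X := by
  classical
  have hH : A.IsHermitian := by
    rw [Matrix.IsHermitian, Matrix.conjTranspose_eq_transpose_of_trivial, hA]
  set U : Matrix ι ι ℝ := (hH.eigenvectorUnitary : Matrix ι ι ℝ) with hU
  set e := hH.eigenvalues with he
  have hUU : star U * U = 1 := Unitary.coe_star_mul_self hH.eigenvectorUnitary
  have hs : star U = Uᵀ := by
    rw [Matrix.star_eq_conjTranspose, Matrix.conjTranspose_eq_transpose_of_trivial]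
  have hUU' : Uᵀ * U = 1 := by rw [← hs, hUU]
  have key : ∀ f g : ι → ℝ, (U * diagonal f * Uᵀ) * (U * diagonal g * Uᵀ)
      = U * diagonal (fun i => f i * g i) * Uᵀ := by
    intro f g
    calc (U * diagonal f * Uᵀ) * (U * diagonal g * Uᵀ)
        = U * diagonal f * (Uᵀ * U) * diagonal g * Uᵀ := by simp only [Matrix.mul_assoc]
      _ = U * diagonal (fun i => f i * g i) * Uᵀ := by
          rw [hUU', Matrix.mul_one, Matrix.mul_assoc U, diagonal_mul_diagonal]
  have htr : ∀ f : ι → ℝ, (U * diagonal f * Uᵀ)ᵀ = U * diagonal f * Uᵀ := by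
    intro f
    simp [Matrix.transpose_mul, Matrix.mul_assoc]
  have hspec : A = U * diagonal e * Uᵀ := by
    have := hH.spectral_theorem
    rw [Unitary.conjStarAlgAut_apply] at this
    rw [← hs]
    exact this
  refine ⟨U * diagonal (fun i => (e i)⁻¹) * Uᵀ, ?_⟩
  rw [hspec]
  refine ⟨?_, ?_, ?_, ?_⟩ <;> simp only [key, htr]
  · congr 3; ext i; by_cases h : e i = 0 <;> simp [h]
  · congr 3; ext i; by_cases h : e i = 0 <;> simp [h]

/-! ### The generalized Procrustes cost matrix

There are `n` points and `m` views; `(k, i) ∈ E` means that point `k` lies in view `i`, and then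
`x k i` is its vector of local coordinates in that view. -/

/-- The vector `e_{ki} = e_k - e_{n+i}`. -/
def edgeVec {n m : ℕ} (k : Fin n) (i : Fin m) : Fin n ⊕ Fin m → ℝ :=
  Pi.single (Sum.inl k) 1 - Pi.single (Sum.inr i) 1

/-- The combinatorial Laplacian of the bipartite graph, `∑ e_{ki} e_{ki}ᵀ`. -/
def laplacian {n m : ℕ} (E : Finset (Fin n × Fin m)) :
    Matrix (Fin n ⊕ Fin m) (Fin n ⊕ Fin m) ℝ :=
  ∑ e ∈ E, vecMulVec (edgeVec e.1 e.2) (edgeVec e.1 e.2)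

theorem isPinv_pinv_laplacian {n m : ℕ} (E : Finset (Fin n × Fin m)) :
    IsPinv (laplacian E) (pinv (laplacian E)) := by
  have h : ∃ X, IsPinv (laplacian E) X := exists_isPinv (by
    simp [laplacian, Matrix.transpose_sum, Matrix.transpose_vecMulVec])
  rw [pinv, dif_pos h]
  exact h.choose_spec

/-- The vector `v ∈ ℝ^d` placed in the `i`th of `m` blocks, i.e. `(e_i ⊗ I_d) v`. -/
def blockVec {m d : ℕ} (i : Fin m) (v : Fin d → ℝ) : Fin m × Fin d → ℝ :=
  fun p => if p.1 = i then v p.2 else 0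

/-- `B = ∑ (e_i ⊗ I_d) x_{k,i} e_{ki}ᵀ`. -/
def matB {n m d : ℕ} (E : Finset (Fin n × Fin m)) (x : Fin n → Fin m → Fin d → ℝ) :
    Matrix (Fin m × Fin d) (Fin n ⊕ Fin m) ℝ :=
  ∑ e ∈ E, vecMulVec (blockVec e.2 (x e.1 e.2)) (edgeVec e.1 e.2)

/-- `D`, block diagonal with blocks `∑_k x_{k,i} x_{k,i}ᵀ`. -/
def matD {n m d : ℕ} (E : Finset (Fin n × Fin m)) (x : Fin n → Fin m → Fin d → ℝ) :
    Matrix (Fin m × Fin d) (Fin m × Fin d) ℝ :=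
  ∑ e ∈ E, vecMulVec (blockVec e.2 (x e.1 e.2)) (blockVec e.2 (x e.1 e.2))

/-- The cost matrix `C = D - B L_Γ^† Bᵀ`. -/
def matC {n m d : ℕ} (E : Finset (Fin n × Fin m)) (x : Fin n → Fin m → Fin d → ℝ) :
    Matrix (Fin m × Fin d) (Fin m × Fin d) ℝ :=
  matD E x - matB E x * pinv (laplacian E) * (matB E x)ᵀ

/-! ### The manifold `O(d)^m` and its quotient by `O(d)` -/

/-- `O(d)^m`, with the product topology. -/
abbrev OrthPow (m d : ℕ) : Type := Fin m → Matrix.orthogonalGroup (Fin d) ℝ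

/-- Vertical stacking of `m` blocks of size `d × d`. -/
def stack {m d : ℕ} (Z : Fin m → Matrix (Fin d) (Fin d) ℝ) : Matrix (Fin m × Fin d) (Fin d) ℝ :=
  Matrix.of fun p c => Z p.1 p.2 c

/-- The blocks of `S` as plain matrices. -/
def blocks {m d : ℕ} (S : OrthPow m d) : Fin m → Matrix (Fin d) (Fin d) ℝ :=
  fun i => (S i : Matrix (Fin d) (Fin d) ℝ)

/-- The cost `F(S) = Tr(C S Sᵀ)`. -/
def cost {m d : ℕ} (C : Matrix (Fin m × Fin d) (Fin m × Fin d) ℝ) (S : OrthPow m d) : ℝ :=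
  (C * (stack (blocks S) * (stack (blocks S))ᵀ)).trace

/-- `S ∼ S'` when `S' = S Q` for some `Q ∈ O(d)`. -/
instance alignSetoid (m d : ℕ) : Setoid (OrthPow m d) where
  r S S' := ∃ Q : Matrix.orthogonalGroup (Fin d) ℝ, ∀ i, S' i = S i * Q
  iseqv :=
    { refl := fun S => ⟨1, fun i => (mul_one _).symm⟩
      symm := by
        rintro S S' ⟨Q, h⟩
        exact ⟨Q⁻¹, fun i => by rw [h i, mul_inv_cancel_right]⟩
      trans := by
        rintro S S' S'' ⟨Q, h⟩ ⟨R, h'⟩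
        exact ⟨Q * R, fun i => by rw [h' i, h i, mul_assoc]⟩ }

/-- The quotient `O(d)^m / O(d)`, with the quotient topology. -/
abbrev AlignSpace (m d : ℕ) : Type := Quotient (alignSetoid m d)

/-- The projection `π : O(d)^m → O(d)^m / O(d)`. -/
def proj {m d : ℕ} (S : OrthPow m d) : AlignSpace m d := Quotient.mk (alignSetoid m d) S

theorem cost_invariant {m d : ℕ} (C : Matrix (Fin m × Fin d) (Fin m × Fin d) ℝ)
    (S S' : OrthPow m d) (h : S ≈ S') : cost C S = cost C S' := by
  obtain ⟨Q, hQ⟩ := h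
  have e : stack (blocks S') = stack (blocks S) * (Q : Matrix (Fin d) (Fin d) ℝ) := by
    ext p c
    simp [stack, blocks, hQ, Matrix.mul_apply]
  have hq : (Q : Matrix (Fin d) (Fin d) ℝ) * (Q : Matrix (Fin d) (Fin d) ℝ)ᵀ = 1 :=
    (Matrix.mem_orthogonalGroup_iff (Fin d) ℝ).1 Q.2
  have e2 : stack (blocks S') * (stack (blocks S'))ᵀ
      = stack (blocks S) * (stack (blocks S))ᵀ := by
    rw [e, Matrix.transpose_mul, Matrix.mul_assoc, ← Matrix.mul_assoc _ _ (stack (blocks S))ᵀ, hq,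
      Matrix.one_mul]
  rw [cost, cost, e2]

/-- The induced cost `F̃` on the quotient, `F̃(π(S)) = F(S)`. -/
def quotCost {m d : ℕ} (C : Matrix (Fin m × Fin d) (Fin m × Fin d) ℝ) : AlignSpace m d → ℝ :=
  Quotient.lift (cost C) (cost_invariant C)

/-! ### Tangent, vertical and horizontal spaces -/

/-- The Frobenius metric `g(Z, W) = Tr(Zᵀ W)` on stacked blocks. -/
def metric {m d : ℕ} (Z W : Fin m → Matrix (Fin d) (Fin d) ℝ) : ℝ :=
  ∑ i, ((Z i)ᵀ * W i).trace

/-- `T_S O(d)^m`. -/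
def tangentSp {m d : ℕ} (S : OrthPow m d) : Submodule ℝ (Fin m → Matrix (Fin d) (Fin d) ℝ) where
  carrier := {Z | ∀ i, (blocks S i)ᵀ * Z i + (Z i)ᵀ * blocks S i = 0}
  zero_mem' := by intro i; simp
  add_mem' := by
    intro Z W hZ hW i
    have h1 := hZ i
    have h2 := hW i
    calc _ = ((blocks S i)ᵀ * Z i + (Z i)ᵀ * blocks S i)
          + ((blocks S i)ᵀ * W i + (W i)ᵀ * blocks S i) := by
          simp only [Pi.add_apply, Matrix.transpose_add, Matrix.mul_add, Matrix.add_mul]; abel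
      _ = 0 := by rw [h1, h2, add_zero]
  smul_mem' := by
    intro c Z hZ i
    have h1 := hZ i
    simp only [Pi.smul_apply, Matrix.transpose_smul, Matrix.mul_smul, Matrix.smul_mul]
    rw [← smul_add, h1, smul_zero]

/-- The vertical space `V_S = {S Ω : Ω skew-symmetric}`, tangent to the fibre of `π` through `S`. -/
def verticalSet {m d : ℕ} (S : OrthPow m d) : Set (Fin m → Matrix (Fin d) (Fin d) ℝ) :=
  {Z | ∃ Ω : Matrix (Fin d) (Fin d) ℝ, Ωᵀ = -Ω ∧ ∀ i, Z i = blocks S i * Ω}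

/-- The horizontal space `H_S`, the orthogonal complement of `V_S` in `T_S O(d)^m`. It represents
the tangent space of the quotient at `π(S)`, a tangent vector corresponding to its horizontal
lift at `S`. -/
def horizontalSp {m d : ℕ} (S : OrthPow m d) :
    Submodule ℝ (Fin m → Matrix (Fin d) (Fin d) ℝ) where
  carrier := {Z | Z ∈ tangentSp S ∧ ∀ W ∈ verticalSet S, metric W Z = 0}
  zero_mem' := ⟨(tangentSp S).zero_mem, by intro W _; simp [metric]⟩
  add_mem' := by
    rintro Z Z' ⟨hZ, h⟩ ⟨hZ', h'⟩
    refine ⟨(tangentSp S).add_mem hZ hZ', fun W hW => ?_⟩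
    have e := h W hW
    have e' := h' W hW
    simp only [metric] at e e'
    simp [metric, Matrix.mul_add, Finset.sum_add_distrib, e, e']
  smul_mem' := by
    rintro c Z ⟨hZ, h⟩
    refine ⟨(tangentSp S).smul_mem c hZ, fun W hW => ?_⟩
    have e := h W hW
    simp only [metric] at e
    simp [metric, ← Finset.mul_sum, e]

/-- The orthogonal projection `T_S O(d)^m → H_S`: subtract the vertical part `S Ω̄`, where `Ω̄` is
the mean of the `Ω_i = S_iᵀ Z_i`. -/
def horProj {m d : ℕ} (S : OrthPow m d) (Z : Fin m → Matrix (Fin d) (Fin d) ℝ) :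
    Fin m → Matrix (Fin d) (Fin d) ℝ :=
  fun i => Z i - (m : ℝ)⁻¹ • (blocks S i * ∑ j, (blocks S j)ᵀ * Z j)

theorem exp_mem_orthogonalGroup {d : ℕ} {Ω : Matrix (Fin d) (Fin d) ℝ} (h : Ωᵀ = -Ω) :
    NormedSpace.exp Ω ∈ Matrix.orthogonalGroup (Fin d) ℝ := by
  rw [Matrix.mem_orthogonalGroup_iff, ← Matrix.exp_transpose, h,
    ← Matrix.exp_add_of_commute _ _ ((Commute.refl Ω).neg_right), add_neg_cancel,
    NormedSpace.exp_zero]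

theorem skew_of_tangent {m d : ℕ} {S : OrthPow m d} {Z : Fin m → Matrix (Fin d) (Fin d) ℝ}
    (hZ : Z ∈ tangentSp S) (i : Fin m) :
    ((blocks S i)ᵀ * Z i)ᵀ = -((blocks S i)ᵀ * Z i) := by
  have := hZ i
  rw [Matrix.transpose_mul, Matrix.transpose_transpose]
  exact eq_neg_of_add_eq_zero_right this

/-- The exponential map of `O(d)^m` on horizontal vectors, `Z ↦ [S_i exp(S_iᵀ Z_i)]`. Composed with
`π`, it is a parametrization of a neighbourhood of `π(S)` by a neighbourhood of `0` in `H_S`. -/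
def expMap {m d : ℕ} (S : OrthPow m d) (Z : horizontalSp S) : OrthPow m d :=
  fun i => S i * ⟨NormedSpace.exp ((blocks S i)ᵀ * Z.1 i),
    exp_mem_orthogonalGroup (skew_of_tangent Z.2.1 i)⟩

/-- The derivative of `expMap S` at `Z` in the direction `U`, entry by entry. -/
def dExpMap {m d : ℕ} (S : OrthPow m d) (Z U : horizontalSp S) :
    Fin m → Matrix (Fin d) (Fin d) ℝ :=
  fun i => Matrix.of fun a b => lineDeriv ℝ (fun Y => blocks (expMap S Y) i a b) Z U

/-- The quotient metric in the coordinates `π ∘ expMap S`: `g̃` of two tangent vectors is `g` of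
their horizontal lifts. -/
def quotMetric {m d : ℕ} (S : OrthPow m d) (Z U V : horizontalSp S) : ℝ :=
  metric (horProj (expMap S Z) (dExpMap S Z U)) (horProj (expMap S Z) (dExpMap S Z V))

/-- A function on the quotient in the coordinates `π ∘ expMap S` around `π(S)`. -/
def inCoords {m d : ℕ} (f : AlignSpace m d → ℝ) (S : OrthPow m d) (Z : horizontalSp S) : ℝ :=
  f (proj (expMap S Z))

/-! ### Critical points and the Riemannian Hessian

All functions differentiated below are smooth near the point in question, so that line derivatives
are the values of the derivative. -/

/-- The Christoffel symbols of a metric `G` given in coordinates on `E`,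
`Γ^k(u,v) = ½ ∑_l G^{kl} (∂_u G(v, e_l) + ∂_v G(u, e_l) - ∂_l G(u,v))`, as a vector of `E`. -/
def christoffel {E : Type*} [AddCommGroup E] [Module ℝ E] [FiniteDimensional ℝ E]
    (G : E → E → E → ℝ) (p u v : E) : E :=
  let b := Module.finBasis ℝ E
  let gram : Matrix (Fin (Module.finrank ℝ E)) (Fin (Module.finrank ℝ E)) ℝ :=
    Matrix.of fun k l => G p (b k) (b l)
  let w : Fin (Module.finrank ℝ E) → ℝ := fun l =>
    lineDeriv ℝ (fun q => G q v (b l)) p u + lineDeriv ℝ (fun q => G q u (b l)) p v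
      - lineDeriv ℝ (fun q => G q u v) p (b l)
  ∑ k, ((1 / 2 : ℝ) * (gram⁻¹ *ᵥ w) k) • b k

/-- The Riemannian Hessian `Hess f = ∇ df` (Levi-Civita connection of `G`) as a bilinear form, in
coordinates: `∂_u ∂_v f - df(Γ(u,v))`. -/
def coordHess {E : Type*} [AddCommGroup E] [Module ℝ E] [FiniteDimensional ℝ E]
    (G : E → E → E → ℝ) (f : E → ℝ) (p u v : E) : ℝ :=
  lineDeriv ℝ (fun q => lineDeriv ℝ f q v) p u - lineDeriv ℝ f p (christoffel G p u v)

/-- `g̃(Hess f(π(S))[Ũ], Ṽ)`, where `U, V ∈ H_S` are the horizontal lifts of `Ũ, Ṽ`. -/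
def quotHess {m d : ℕ} (f : AlignSpace m d → ℝ) (S : OrthPow m d) (U V : horizontalSp S) : ℝ :=
  coordHess (quotMetric S) (inCoords f S) 0 U V

/-- `π(S)` is a critical point of `f`: the differential of `f` vanishes there. -/
def IsCriticalAt {m d : ℕ} (f : AlignSpace m d → ℝ) (S : OrthPow m d) : Prop :=
  ∀ U : horizontalSp S, lineDeriv ℝ (inCoords f S) 0 U = 0

/-- `π(S)` is a local minimum of `f` at which the Hessian is nonsingular. -/
def IsNondegLocalMin {m d : ℕ} (f : AlignSpace m d → ℝ) (S : OrthPow m d) : Prop :=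
  IsLocalMin f (proj S) ∧
    ∀ U : horizontalSp S, (∀ V : horizontalSp S, quotHess f S U V = 0) → U = 0

/-! ### The matrices `L(S)` and `𝕃(S)` -/

/-- The block diagonal matrix with the given blocks. -/
def blkDiag {m d : ℕ} (A : Fin m → Matrix (Fin d) (Fin d) ℝ) :
    Matrix (Fin m × Fin d) (Fin m × Fin d) ℝ :=
  Matrix.of fun p q => if p.1 = q.1 then A p.1 p.2 q.2 else 0

/-- `C(S) = block-diag(S_i)ᵀ C block-diag(S_i)`, with blocks `S_iᵀ C_{ij} S_j`. -/
def matCS {m d : ℕ} (C : Matrix (Fin m × Fin d) (Fin m × Fin d) ℝ) (S : OrthPow m d) :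
    Matrix (Fin m × Fin d) (Fin m × Fin d) ℝ :=
  (blkDiag (blocks S))ᵀ * C * blkDiag (blocks S)

/-- `Ĉ(S)`, block diagonal with `i`th block `∑_j C(S)_{ij}`. -/
def matChat {m d : ℕ} (C : Matrix (Fin m × Fin d) (Fin m × Fin d) ℝ) (S : OrthPow m d) :
    Matrix (Fin m × Fin d) (Fin m × Fin d) ℝ :=
  blkDiag fun i => Matrix.of fun a b => ∑ j, matCS C S (i, a) (j, b)

/-- `L(S) = C(S) - Ĉ(S)`. -/
def matL {m d : ℕ} (C : Matrix (Fin m × Fin d) (Fin m × Fin d) ℝ) (S : OrthPow m d) :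
    Matrix (Fin m × Fin d) (Fin m × Fin d) ℝ :=
  matCS C S - matChat C S

/-- The `d(d-1)/2` strictly lower triangular positions of a `d × d` matrix. -/
abbrev LowerPos (d : ℕ) : Type := {p : Fin d × Fin d // p.2 < p.1}

/-- The skew-symmetric matrix whose strictly lower triangular entries are `ω`. -/
def skewOf {d : ℕ} (ω : LowerPos d → ℝ) : Matrix (Fin d) (Fin d) ℝ :=
  Matrix.of fun r c =>
    if h : c < r then ω ⟨(r, c), h⟩ else if h : r < c then -ω ⟨(c, r), h⟩ else 0

/-- `ω = [ω_i] ↦ Ω = [Ω_i]`, where `Ω_i` is the skew-symmetric matrix of `ω_i`. -/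
def skewBlocks {m d : ℕ} (ω : Fin m × LowerPos d → ℝ) : Fin m → Matrix (Fin d) (Fin d) ℝ :=
  fun i => skewOf fun a => ω (i, a)

/-- The matrix of the linear map `ω ↦ vec(Ω)`; its entries are `0`, `1`, `-1`. -/
def skewVec (m d : ℕ) : Matrix (Fin d × (Fin m × Fin d)) (Fin m × LowerPos d) ℝ :=
  Matrix.of fun p q => Matrix.vec (stack (skewBlocks (Pi.single q 1))) p

theorem skewVec_mulVec {m d : ℕ} (ω : Fin m × LowerPos d → ℝ) :
    skewVec m d *ᵥ ω = Matrix.vec (stack (skewBlocks ω)) := by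
  ext ⟨c, i, r⟩
  simp only [Matrix.mulVec, dotProduct, skewVec, Matrix.vec, stack, skewBlocks, skewOf,
    Matrix.of_apply]
  by_cases h : c < r
  · simp [h, Pi.single_apply]
  · by_cases h' : r < c
    · simp [h, h', Pi.single_apply]
    · simp [h, h']

/-- The matrix `𝕃(S)` of size `m d(d-1)/2` of the quadratic form `Tr(Ωᵀ L(S) Ω)` in the
coordinates `ω`, namely `Jᵀ (I_d ⊗ L(S)) J` with `vec(Ω) = J ω`. -/
def matLL {m d : ℕ} (C : Matrix (Fin m × Fin d) (Fin m × Fin d) ℝ) (S : OrthPow m d) :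
    Matrix (Fin m × LowerPos d) (Fin m × LowerPos d) ℝ :=
  (skewVec m d)ᵀ * ((1 : Matrix (Fin d) (Fin d) ℝ) ⊗ₖ matL C S) * skewVec m d

end Procrustes

end

/-!
For `R ∈ O(d)^m` put `X = R - 1`. The cost at `S R` is quadratic in `X`: it is
`F(S) + Tr(Xᵀ C(S) X) + 2 ∑ Tr(c_iᵀ X_i)`, where `c_i` is the `i`th block row sum of `C(S)`
(`cost_mul`). If `π(S)` is critical, all `c_i` are symmetric (`rowSum_symm_of_isCriticalAt`), hence
so is `L(S)`. The relation `X_i + X_iᵀ = -X_i X_iᵀ` then turns the linear term into the quadratic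
form of `-Ĉ(S)`, and `F(S R) - F(S) = Tr(Xᵀ L(S) X)` holds exactly (`cost_mul_of_rowSum_symm`).

Left translation `Z ↦ [S_iᵀ Z_i]` identifies horizontal vectors with skew blocks of sum zero. In the
chart `π ∘ expMap S` one has `X = exp(Ω) - 1`, which is `Ω` to first order. The Christoffel term of
the Hessian vanishes at a critical point, so the Hessian is twice the form of `L(S)`
(`quotHess_eq`), whatever the metric.

At a local minimum this form is nonnegative on skew blocks of sum zero
(`traceForm_nonneg_of_isLocalMin`), hence positive if it is nonsingular. Conversely, suppose that it
is positive there. Given `S'` near `S`, choose the orthogonal `Q` that maximizes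
`Tr(∑ S_iᵀ S'_i Q)`. The blocks `R_i = S_iᵀ S'_i Q` are still close to `1`, and their sum is
symmetric. So the skew part of `R - 1` has sum zero, while its symmetric part is of second
order; coercivity gives `F(S') ≥ F(S)` (`isLocalMin_of_pos`). This replaces a local slice for the action of `O(d)`.

The remaining equivalences are linear algebra: `L(S)` annihilates stacks of equal blocks
(`pos_on_skewZero_iff`), so `𝕃(S)` annihilates the `d(d-1)/2`-dimensional space of constant families
(`pos_iff_posSemidef_and_rank`, `posSemidef_and_rank_iff_eigenvalue_pos`).
-/

noncomputable section

namespace Procrustes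

variable {n m d : ℕ}

/-! ### Stacked blocks -/

theorem IsPinv.transpose {ι κ : Type*} [Fintype ι] [Fintype κ] {A : Matrix ι κ ℝ}
    {X : Matrix κ ι ℝ} (h : IsPinv A X) : IsPinv Aᵀ Xᵀ := by
  obtain ⟨h1, h2, h3, h4⟩ := h
  refine ⟨?_, ?_, ?_, ?_⟩
  · rw [← transpose_mul, ← transpose_mul, ← Matrix.mul_assoc, h1]
  · rw [← transpose_mul, ← transpose_mul, ← Matrix.mul_assoc, h2]
  · rw [← transpose_mul, h4, h4]
  · rw [← transpose_mul, h3, h3]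

theorem laplacian_transpose (E : Finset (Fin n × Fin m)) : (laplacian E)ᵀ = laplacian E := by
  simp [laplacian, Matrix.transpose_sum, Matrix.transpose_vecMulVec]

theorem matC_transpose (E : Finset (Fin n × Fin m)) (x : Fin n → Fin m → Fin d → ℝ) :
    (matC E x)ᵀ = matC E x := by
  have hp : (pinv (laplacian E))ᵀ = pinv (laplacian E) := by
    have h := (isPinv_pinv_laplacian E).transpose
    rw [laplacian_transpose] at h
    exact h.unique (isPinv_pinv_laplacian E)
  have hD : (matD E x)ᵀ = matD E x := by
    simp [matD, Matrix.transpose_sum, Matrix.transpose_vecMulVec]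
  rw [matC, transpose_sub, hD, transpose_mul, transpose_mul, hp, transpose_transpose,
    Matrix.mul_assoc]

theorem stack_add (X Y : Fin m → Matrix (Fin d) (Fin d) ℝ) :
    stack (X + Y) = stack X + stack Y := rfl

theorem stack_smul (c : ℝ) (X : Fin m → Matrix (Fin d) (Fin d) ℝ) :
    stack (c • X) = c • stack X := rfl

theorem stack_transpose_mul_stack (X Y : Fin m → Matrix (Fin d) (Fin d) ℝ) :
    (stack X)ᵀ * stack Y = ∑ i, (X i)ᵀ * Y i := by
  ext a b
  simp [Matrix.mul_apply, Matrix.sum_apply, stack, Fintype.sum_prod_type]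

theorem blkDiag_mul_stack (A Y : Fin m → Matrix (Fin d) (Fin d) ℝ) :
    blkDiag A * stack Y = stack fun i => A i * Y i := by
  ext ⟨i, a⟩ b
  simp [Matrix.mul_apply, stack, blkDiag, Fintype.sum_prod_type]

theorem blkDiag_transpose (A : Fin m → Matrix (Fin d) (Fin d) ℝ) :
    (blkDiag A)ᵀ = blkDiag fun i => (A i)ᵀ := by
  ext ⟨i, a⟩ ⟨j, b⟩
  by_cases h : i = j
  · subst h; simp [blkDiag]
  · simp [blkDiag, h, Ne.symm h]

/-- The bilinear form `(X, Y) ↦ Tr(Xᵀ M Y)` on stacked blocks. -/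
def traceForm (M : Matrix (Fin m × Fin d) (Fin m × Fin d) ℝ) :
    (Fin m → Matrix (Fin d) (Fin d) ℝ) →ₗ[ℝ] (Fin m → Matrix (Fin d) (Fin d) ℝ) →ₗ[ℝ] ℝ :=
  LinearMap.mk₂ ℝ (fun X Y => ((stack X)ᵀ * M * stack Y).trace)
    (fun X X' Y => by simp [stack_add, Matrix.add_mul])
    (fun c X Y => by simp [stack_smul])
    (fun X Y Y' => by simp [stack_add, Matrix.mul_add])
    (fun c X Y => by simp [stack_smul])

theorem traceForm_apply (M : Matrix (Fin m × Fin d) (Fin m × Fin d) ℝ)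
    (X Y : Fin m → Matrix (Fin d) (Fin d) ℝ) :
    traceForm M X Y = ((stack X)ᵀ * M * stack Y).trace := rfl

theorem traceForm_comm {M : Matrix (Fin m × Fin d) (Fin m × Fin d) ℝ} (hM : Mᵀ = M)
    (X Y : Fin m → Matrix (Fin d) (Fin d) ℝ) : traceForm M X Y = traceForm M Y X := by
  rw [traceForm_apply, traceForm_apply, ← Matrix.trace_transpose]
  simp [Matrix.transpose_mul, hM, Matrix.mul_assoc]

theorem traceForm_sub (M N : Matrix (Fin m × Fin d) (Fin m × Fin d) ℝ)
    (X Y : Fin m → Matrix (Fin d) (Fin d) ℝ) :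
    traceForm (M - N) X Y = traceForm M X Y - traceForm N X Y := by
  simp [traceForm_apply, Matrix.mul_sub, Matrix.sub_mul]

theorem traceForm_blkDiag (A X Y : Fin m → Matrix (Fin d) (Fin d) ℝ) :
    traceForm (blkDiag A) X Y = ∑ i, ((X i)ᵀ * (A i * Y i)).trace := by
  rw [traceForm_apply, Matrix.mul_assoc, blkDiag_mul_stack, stack_transpose_mul_stack,
    Matrix.trace_sum]

/-! ### The block row sums of `C(S)` -/

/-- The block row sum `∑_j C(S)_{ij}`, the `i`th diagonal block of `Ĉ(S)`. -/
def rowSum (C : Matrix (Fin m × Fin d) (Fin m × Fin d) ℝ) (S : OrthPow m d) (i : Fin m) :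
    Matrix (Fin d) (Fin d) ℝ :=
  Matrix.of fun a b => ∑ j, matCS C S (i, a) (j, b)

theorem matChat_eq (C : Matrix (Fin m × Fin d) (Fin m × Fin d) ℝ) (S : OrthPow m d) :
    matChat C S = blkDiag (rowSum C S) := rfl

variable {C : Matrix (Fin m × Fin d) (Fin m × Fin d) ℝ}

theorem matCS_transpose (hC : Cᵀ = C) (S : OrthPow m d) : (matCS C S)ᵀ = matCS C S := by
  simp [matCS, Matrix.transpose_mul, hC, Matrix.mul_assoc]

theorem matCS_mul_stack_const (C : Matrix (Fin m × Fin d) (Fin m × Fin d) ℝ) (S : OrthPow m d)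
    (K : Matrix (Fin d) (Fin d) ℝ) :
    matCS C S * stack (fun _ : Fin m => K) = stack fun i => rowSum C S i * K := by
  ext ⟨i, a⟩ b
  simp only [Matrix.mul_apply, stack, rowSum, Matrix.of_apply, Fintype.sum_prod_type,
    Finset.sum_mul]
  rw [Finset.sum_comm]

theorem matL_mul_stack_const (C : Matrix (Fin m × Fin d) (Fin m × Fin d) ℝ) (S : OrthPow m d)
    (K : Matrix (Fin d) (Fin d) ℝ) : matL C S * stack (fun _ : Fin m => K) = 0 := by
  rw [matL, Matrix.sub_mul, matCS_mul_stack_const, matChat_eq, blkDiag_mul_stack, sub_self]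

theorem sum_rowSum_transpose (hC : Cᵀ = C) (S : OrthPow m d) :
    (∑ i, rowSum C S i)ᵀ = ∑ i, rowSum C S i := by
  have h : ∑ i, rowSum C S i
      = (stack fun _ : Fin m => (1 : Matrix (Fin d) (Fin d) ℝ))ᵀ
        * (matCS C S * stack fun _ : Fin m => (1 : Matrix (Fin d) (Fin d) ℝ)) := by
    rw [matCS_mul_stack_const, stack_transpose_mul_stack]
    simp
  rw [h]
  simp [Matrix.transpose_mul, matCS_transpose hC, Matrix.mul_assoc]

theorem matL_transpose (hC : Cᵀ = C) {S : OrthPow m d}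
    (hc : ∀ i, (rowSum C S i)ᵀ = rowSum C S i) : (matL C S)ᵀ = matL C S := by
  rw [matL, transpose_sub, matCS_transpose hC, matChat_eq, blkDiag_transpose]
  simp only [hc]

/-! ### Exact expansion of the cost -/

theorem cost_eq_trace (C : Matrix (Fin m × Fin d) (Fin m × Fin d) ℝ) (S : OrthPow m d) :
    cost C S = ((stack (blocks S))ᵀ * C * stack (blocks S)).trace := by
  rw [cost, ← Matrix.mul_assoc, Matrix.trace_mul_comm, Matrix.mul_assoc]

/-- Second-order expansion of the cost along `X = R - 1`, with no remainder term. -/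
theorem cost_mul (hC : Cᵀ = C) (S R : OrthPow m d) :
    cost C (fun i => S i * R i) = cost C S + traceForm (matCS C S) (blocks R - 1) (blocks R - 1)
      + 2 * ∑ i, ((rowSum C S i)ᵀ * (blocks R - 1) i).trace := by
  have hst : stack (blocks fun i => S i * R i) = blkDiag (blocks S) * stack (blocks R) := by
    rw [blkDiag_mul_stack]; rfl
  have h1 : blkDiag (blocks S) * stack (1 : Fin m → Matrix (Fin d) (Fin d) ℝ)
      = stack (blocks S) := by
    rw [blkDiag_mul_stack]; simp
  have key : cost C (fun i => S i * R i) = traceForm (matCS C S) (blocks R) (blocks R) := by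
    rw [cost_eq_trace, hst, traceForm_apply, matCS, Matrix.transpose_mul]
    simp only [Matrix.mul_assoc]
  have key1 : cost C S = traceForm (matCS C S) 1 1 := by
    rw [cost_eq_trace, ← h1, traceForm_apply, matCS, Matrix.transpose_mul]
    simp only [Matrix.mul_assoc]
  have hlin : ∀ X, traceForm (matCS C S) X 1 = ∑ i, ((rowSum C S i)ᵀ * X i).trace := by
    intro X
    rw [traceForm_apply, Matrix.mul_assoc,
      show (1 : Fin m → Matrix (Fin d) (Fin d) ℝ) = fun _ : Fin m => 1 from rfl,
      matCS_mul_stack_const,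
      stack_transpose_mul_stack, Matrix.trace_sum]
    refine Finset.sum_congr rfl fun i _ => ?_
    rw [← Matrix.trace_transpose]
    simp
  obtain ⟨X, hX⟩ : ∃ X, blocks R - 1 = X := ⟨_, rfl⟩
  have hR : blocks R = 1 + X := by rw [← hX]; simp
  rw [key, key1, hX, ← hlin, hR]
  simp only [map_add, LinearMap.add_apply]
  rw [traceForm_comm (matCS_transpose hC S) 1 X]
  ring

theorem blocks_sub_one_mul_transpose (R : OrthPow m d) (i : Fin m) :
    (blocks R - 1) i * ((blocks R - 1) i)ᵀ = -((blocks R - 1) i + ((blocks R - 1) i)ᵀ) := by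
  have h : blocks R i * (blocks R i)ᵀ = 1 := (Matrix.mem_orthogonalGroup_iff (Fin d) ℝ).1 (R i).2
  simp only [Pi.sub_apply, Pi.one_apply, transpose_sub, transpose_one, Matrix.sub_mul,
    Matrix.mul_sub, h, Matrix.one_mul, Matrix.mul_one]
  abel

theorem blocks_sub_one_transpose_mul (R : OrthPow m d) (i : Fin m) :
    ((blocks R - 1) i)ᵀ * (blocks R - 1) i = -((blocks R - 1) i + ((blocks R - 1) i)ᵀ) := by
  have h : (blocks R i)ᵀ * blocks R i = 1 :=
    (Matrix.mem_orthogonalGroup_iff' (Fin d) ℝ).1 (R i).2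
  simp only [Pi.sub_apply, Pi.one_apply, transpose_sub, transpose_one, Matrix.sub_mul,
    Matrix.mul_sub, h, Matrix.one_mul, Matrix.mul_one]
  abel

/-- If the block row sums of `C(S)` are symmetric, the cost differs from its value at `S` exactly
by the quadratic form of `L(S)` at `R - 1`: orthogonality of `R` turns the linear term of
`cost_mul` into the quadratic form of `-Ĉ(S)`. -/
theorem cost_mul_of_rowSum_symm (hC : Cᵀ = C) {S : OrthPow m d}
    (hc : ∀ i, (rowSum C S i)ᵀ = rowSum C S i) (R : OrthPow m d) :
    cost C (fun i => S i * R i)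
      = cost C S + traceForm (matL C S) (blocks R - 1) (blocks R - 1) := by
  rw [cost_mul hC, matL, traceForm_sub, matChat_eq, traceForm_blkDiag, Finset.mul_sum, add_assoc,
    sub_eq_add_neg (traceForm (matCS C S) _ _), ← Finset.sum_neg_distrib]
  congr 2
  refine Finset.sum_congr rfl fun i _ => ?_
  have h := blocks_sub_one_mul_transpose R i
  obtain ⟨X, hX⟩ : ∃ X, (blocks R - 1) i = X := ⟨_, rfl⟩
  rw [hX] at h ⊢
  have h2 : (rowSum C S i * Xᵀ).trace = (rowSum C S i * X).trace := by
    rw [← Matrix.trace_transpose, Matrix.transpose_mul, hc, transpose_transpose,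
      Matrix.trace_mul_comm]
  rw [Matrix.trace_mul_comm Xᵀ, Matrix.mul_assoc, h, hc]
  simp [Matrix.mul_add, h2]
  ring

/-! ### Horizontal vectors as skew-symmetric blocks of sum zero -/

/-- Blocks `[Ω_i]` of skew-symmetric matrices with `∑ Ω_i = 0`. -/
def skewZero (m d : ℕ) : Submodule ℝ (Fin m → Matrix (Fin d) (Fin d) ℝ) where
  carrier := {Ω | (∀ i, (Ω i)ᵀ = -Ω i) ∧ ∑ i, Ω i = 0}
  zero_mem' := by simp
  add_mem' := by
    rintro Ω Ω' ⟨h1, h2⟩ ⟨h1', h2'⟩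
    refine ⟨fun i => ?_, by simp [Finset.sum_add_distrib, h2, h2']⟩
    rw [Pi.add_apply, transpose_add, h1, h1', neg_add]
  smul_mem' := by
    rintro c Ω ⟨h1, h2⟩
    exact ⟨fun i => by simp [h1], by simp [← Finset.smul_sum, h2]⟩

/-- Left translation to the identity, `Z ↦ [S_iᵀ Z_i]`. -/
def leftTrans (S : OrthPow m d) :
    (Fin m → Matrix (Fin d) (Fin d) ℝ) →ₗ[ℝ] (Fin m → Matrix (Fin d) (Fin d) ℝ) where
  toFun Z := fun i => (blocks S i)ᵀ * Z i
  map_add' Z W := by ext1 i; simp [Matrix.mul_add]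
  map_smul' c Z := by ext1 i; simp

theorem leftTrans_apply (S : OrthPow m d) (Z : Fin m → Matrix (Fin d) (Fin d) ℝ) (i : Fin m) :
    leftTrans S Z i = (blocks S i)ᵀ * Z i := rfl

theorem blocks_transpose_mul (S : OrthPow m d) (i : Fin m) :
    (blocks S i)ᵀ * blocks S i = 1 :=
  (Matrix.mem_orthogonalGroup_iff' (Fin d) ℝ).1 (S i).2

theorem blocks_mul_transpose (S : OrthPow m d) (i : Fin m) :
    blocks S i * (blocks S i)ᵀ = 1 :=
  (Matrix.mem_orthogonalGroup_iff (Fin d) ℝ).1 (S i).2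

/-- A real matrix `A` with `Tr(Aᵀ A) = 0` vanishes. -/
theorem eq_zero_of_trace_transpose_mul_self {A : Matrix (Fin d) (Fin d) ℝ}
    (h : (Aᵀ * A).trace = 0) : A = 0 := by
  rw [← Matrix.conjTranspose_eq_transpose_of_trivial] at h
  exact Matrix.trace_conjTranspose_mul_self_eq_zero_iff.1 h

theorem trace_transpose_mul_self_nonneg (A : Matrix (Fin d) (Fin d) ℝ) :
    0 ≤ (Aᵀ * A).trace := by
  simp only [Matrix.trace, Matrix.diag, Matrix.mul_apply, Matrix.transpose_apply]
  exact Finset.sum_nonneg fun _ _ => Finset.sum_nonneg fun _ _ => mul_self_nonneg _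

/-- The inner product of `A` with `A - Aᵀ` is half the squared norm of `A - Aᵀ`; so a
matrix orthogonal to its own skew part is symmetric. -/
theorem trace_mul_sub_transpose (A : Matrix (Fin d) (Fin d) ℝ) :
    2 * (Aᵀ * (A - Aᵀ)).trace = ((A - Aᵀ)ᵀ * (A - Aᵀ)).trace := by
  have h : (A * A).trace = (Aᵀ * Aᵀ).trace := by
    rw [← Matrix.transpose_mul, Matrix.trace_transpose]
  simp only [transpose_sub, transpose_transpose, Matrix.mul_sub, Matrix.sub_mul,
    Matrix.trace_sub, h, Matrix.trace_mul_comm A Aᵀ]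
  ring

theorem leftTrans_mem_skewZero {S : OrthPow m d} {Z : Fin m → Matrix (Fin d) (Fin d) ℝ}
    (hZ : Z ∈ horizontalSp S) : leftTrans S Z ∈ skewZero m d := by
  obtain ⟨h1, h2⟩ := hZ
  have hsk : ∀ i, (leftTrans S Z i)ᵀ = -leftTrans S Z i := skew_of_tangent h1
  refine ⟨hsk, eq_zero_of_trace_transpose_mul_self ?_⟩
  have hK : (∑ i, leftTrans S Z i)ᵀ = -∑ i, leftTrans S Z i := by
    rw [Matrix.transpose_sum, ← Finset.sum_neg_distrib]
    exact Finset.sum_congr rfl fun i _ => hsk i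
  have h := h2 (fun i => blocks S i * ∑ i, leftTrans S Z i) ⟨_, hK, fun i => rfl⟩
  rw [metric] at h
  rw [← h, Matrix.mul_sum, Matrix.trace_sum]
  refine Finset.sum_congr rfl fun i _ => ?_
  rw [Matrix.transpose_mul, Matrix.mul_assoc, leftTrans_apply]

theorem leftTrans_injective (S : OrthPow m d) : Function.Injective (leftTrans S) := by
  intro Z W h
  funext i
  have := congrArg (blocks S i * ·) (congrFun h i)
  simpa [leftTrans_apply, ← Matrix.mul_assoc, blocks_mul_transpose] using this

theorem exists_leftTrans_eq {S : OrthPow m d} {Ω : Fin m → Matrix (Fin d) (Fin d) ℝ}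
    (hΩ : Ω ∈ skewZero m d) : ∃ Z : horizontalSp S, leftTrans S Z = Ω := by
  obtain ⟨h1, h2⟩ := hΩ
  have e : ∀ i, (blocks S i)ᵀ * (blocks S i * Ω i) = Ω i := fun i => by
    rw [← Matrix.mul_assoc, blocks_transpose_mul, Matrix.one_mul]
  refine ⟨⟨fun i => blocks S i * Ω i, fun i => ?_, ?_⟩, funext e⟩
  · rw [e, Matrix.transpose_mul, Matrix.mul_assoc, blocks_transpose_mul, h1, Matrix.mul_one,
      add_neg_cancel]
  · rintro W ⟨K, hK, hW⟩
    simp only [metric, hW, Matrix.transpose_mul, Matrix.mul_assoc, e]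
    rw [← Matrix.trace_sum, ← Matrix.mul_sum, h2, Matrix.mul_zero, Matrix.trace_zero]

section Analysis

/-! ### Derivatives through the exponential map -/

open scoped Matrix.Norms.Frobenius
open Filter Topology

/-- `Ω ↦ [exp(Ω_i) - 1]`. -/
def expSub (Ω : Fin m → Matrix (Fin d) (Fin d) ℝ) : Fin m → Matrix (Fin d) (Fin d) ℝ :=
  fun i => NormedSpace.exp (Ω i) - 1

theorem contDiff_expSub : ContDiff ℝ 2 (expSub : (Fin m → Matrix (Fin d) (Fin d) ℝ) → _) := by
  rw [contDiff_pi]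
  intro i
  have h : ContDiff ℝ 2 (NormedSpace.exp : Matrix (Fin d) (Fin d) ℝ → _) :=
    contDiff_iff_contDiffAt.2 fun x => (NormedSpace.exp_analytic (𝕂 := ℝ) x).contDiffAt
  exact (h.comp (contDiff_apply ℝ _ i)).sub contDiff_const

theorem expSub_zero : expSub (0 : Fin m → Matrix (Fin d) (Fin d) ℝ) = 0 := by
  funext i
  simp [expSub]

theorem hasFDerivAt_expSub_zero :
    HasFDerivAt (expSub : (Fin m → Matrix (Fin d) (Fin d) ℝ) → _)
      (ContinuousLinearMap.id ℝ _) 0 := by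
  refine hasFDerivAt_pi'.2 fun i => ?_
  have h : HasFDerivAt (NormedSpace.exp : Matrix (Fin d) (Fin d) ℝ → _)
      (1 : Matrix (Fin d) (Fin d) ℝ →L[ℝ] _) ((0 : Fin m → Matrix (Fin d) (Fin d) ℝ) i) :=
    hasFDerivAt_exp_zero
  have h2 : HasFDerivAt (fun Ω : Fin m → Matrix (Fin d) (Fin d) ℝ => Ω i)
      (ContinuousLinearMap.proj (R := ℝ) i) 0 :=
    (ContinuousLinearMap.proj (R := ℝ)
      (φ := fun _ : Fin m => Matrix (Fin d) (Fin d) ℝ) i).hasFDerivAt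
  exact (HasFDerivAt.comp (0 : Fin m → Matrix (Fin d) (Fin d) ℝ)
    (f := fun Ω : Fin m → Matrix (Fin d) (Fin d) ℝ => Ω i) h h2).sub_const
      (1 : Matrix (Fin d) (Fin d) ℝ)

theorem hasDerivAt_expSub_smul (V : Fin m → Matrix (Fin d) (Fin d) ℝ) :
    HasDerivAt (fun t : ℝ => expSub (t • V)) V 0 := by
  have h := hasFDerivAt_expSub_zero.hasLineDerivAt V
  rw [HasLineDerivAt] at h
  simp only [zero_add] at h
  exact h

/-- The first derivative of a function that is quadratic in `expSub`. -/
theorem hasDerivAt_quadratic_expSub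
    (B : (Fin m → Matrix (Fin d) (Fin d) ℝ) →ₗ[ℝ] (Fin m → Matrix (Fin d) (Fin d) ℝ) →ₗ[ℝ] ℝ)
    (Ω V : Fin m → Matrix (Fin d) (Fin d) ℝ) :
    HasDerivAt (fun t : ℝ => B (expSub (Ω + t • V)) (expSub (Ω + t • V)))
      (B (expSub Ω) (fderiv ℝ expSub Ω V) + B (fderiv ℝ expSub Ω V) (expSub Ω)) 0 := by
  have h : HasDerivAt (fun t : ℝ => expSub (Ω + t • V)) (fderiv ℝ expSub Ω V) 0 := by
    have h1 : HasFDerivAt (expSub : (Fin m → Matrix (Fin d) (Fin d) ℝ) → _)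
        (fderiv ℝ expSub Ω) Ω := (contDiff_expSub.differentiable (by simp) Ω).hasFDerivAt
    exact h1.hasLineDerivAt V
  have := B.toContinuousBilinearMap.hasFDerivAt_of_bilinear h.hasFDerivAt h.hasFDerivAt
  refine this.hasDerivAt.congr_deriv ?_
  change B _ ((1 : ℝ) • _) + B ((1 : ℝ) • _) _ = _
  rw [one_smul, zero_smul, add_zero]

theorem hasDerivAt_linear_expSub (l : (Fin m → Matrix (Fin d) (Fin d) ℝ) →ₗ[ℝ] ℝ)
    (V : Fin m → Matrix (Fin d) (Fin d) ℝ) :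
    HasDerivAt (fun t : ℝ => l (expSub (t • V))) (l V) 0 := by
  exact (l.toContinuousLinearMap.hasFDerivAt.comp_hasDerivAt (0 : ℝ)
    (hasDerivAt_expSub_smul V) :)

/-- For symmetric `B`, half the second derivative at `0` of `B (expSub ·) (expSub ·)` is `B` itself,
as `expSub` is the identity to first order. -/
theorem hasDerivAt_deriv_quadratic_expSub
    (B : (Fin m → Matrix (Fin d) (Fin d) ℝ) →ₗ[ℝ] (Fin m → Matrix (Fin d) (Fin d) ℝ) →ₗ[ℝ] ℝ)
    (U V : Fin m → Matrix (Fin d) (Fin d) ℝ) :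
    HasDerivAt (fun t : ℝ => B (expSub (t • U)) (fderiv ℝ expSub (t • U) V)) (B U V) 0 := by
  have h : HasDerivAt (fun t : ℝ => expSub (t • U)) U 0 :=
    hasDerivAt_expSub_smul U
  have hD : Differentiable ℝ
      (fun Ω => fderiv ℝ (expSub : (Fin m → Matrix (Fin d) (Fin d) ℝ) → _) Ω V) :=
    (contDiff_expSub.fderiv_right (m := 1) (by norm_num)).clm_apply contDiff_const
      |>.differentiable (by simp)
  have h' : DifferentiableAt ℝ (fun t : ℝ => fderiv ℝ expSub (t • U) V) 0 :=
    (hD _).comp (0 : ℝ) ((differentiable_id.smul_const U) _)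
  have := B.toContinuousBilinearMap.hasFDerivAt_of_bilinear h.hasFDerivAt
    h'.hasDerivAt.hasFDerivAt
  refine this.hasDerivAt.congr_deriv ?_
  change B (expSub ((0 : ℝ) • U)) ((1 : ℝ) • _)
    + B ((1 : ℝ) • U) (fderiv ℝ expSub ((0 : ℝ) • U) V) = _
  rw [zero_smul, expSub_zero, hasFDerivAt_expSub_zero.fderiv, one_smul, one_smul, map_zero,
    LinearMap.zero_apply, zero_add]
  rfl

/-! ### Critical points and the Hessian -/

/-- The orthogonal blocks `exp(S_iᵀ Z_i)`, for horizontal `Z`. -/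
def expRot (S : OrthPow m d) (Z : horizontalSp S) : OrthPow m d :=
  fun i => ⟨NormedSpace.exp ((blocks S i)ᵀ * Z.1 i),
    exp_mem_orthogonalGroup (skew_of_tangent Z.2.1 i)⟩

theorem inCoords_eq (hC : Cᵀ = C) (S : OrthPow m d) (Z : horizontalSp S) :
    inCoords (quotCost C) S Z = cost C S
      + traceForm (matCS C S) (expSub (leftTrans S Z)) (expSub (leftTrans S Z))
      + 2 * ∑ i, ((rowSum C S i)ᵀ * expSub (leftTrans S Z) i).trace :=
  cost_mul hC S (expRot S Z)

theorem inCoords_eq_of_rowSum_symm (hC : Cᵀ = C) {S : OrthPow m d}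
    (hc : ∀ i, (rowSum C S i)ᵀ = rowSum C S i) (Z : horizontalSp S) :
    inCoords (quotCost C) S Z = cost C S
      + traceForm (matL C S) (expSub (leftTrans S Z)) (expSub (leftTrans S Z)) :=
  cost_mul_of_rowSum_symm hC hc (expRot S Z)

/-- At a critical point the block row sums of `C(S)` are symmetric. The differential gives this on
skew blocks of sum zero; the skew parts of the row sums form such blocks, since the sum of all
blocks of `C(S)` is symmetric. -/
theorem rowSum_symm_of_isCriticalAt (hC : Cᵀ = C) {S : OrthPow m d}
    (hS : IsCriticalAt (quotCost C) S) (i : Fin m) : (rowSum C S i)ᵀ = rowSum C S i := by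
  let l : (Fin m → Matrix (Fin d) (Fin d) ℝ) →ₗ[ℝ] ℝ :=
    { toFun := fun X => ∑ i, ((rowSum C S i)ᵀ * X i).trace
      map_add' := fun X Y => by simp [Matrix.mul_add, Finset.sum_add_distrib]
      map_smul' := fun c X => by simp [Finset.mul_sum] }
  -- the differential is tested on the skew parts of the row sums
  have hmem : (fun i => rowSum C S i - (rowSum C S i)ᵀ) ∈ skewZero m d := by
    refine ⟨fun i => by simp, ?_⟩
    rw [Finset.sum_sub_distrib, ← Matrix.transpose_sum, sum_rowSum_transpose hC, sub_self]
  obtain ⟨Z, hZ⟩ := exists_leftTrans_eq (S := S) hmem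
  have hl : l (leftTrans S Z) = 0 := by
    have hd1 := hasDerivAt_quadratic_expSub (traceForm (matCS C S)) 0 (leftTrans S Z)
    have hd2 := hasDerivAt_linear_expSub l (leftTrans S Z)
    have hd := (hd1.const_add (cost C S)).add (hd2.const_mul 2)
    simp only [expSub_zero, map_zero, LinearMap.zero_apply, zero_add] at hd
    -- `expSub` vanishes at `0`, so only the linear term of `inCoords_eq` contributes
    have h0 := hS Z
    rw [lineDeriv] at h0
    rw [show (fun t : ℝ => inCoords (quotCost C) S (0 + t • Z)) = _ from
      funext fun t => inCoords_eq hC S (0 + t • Z)] at h0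
    simp only [zero_add, Submodule.coe_smul, map_smul] at h0
    have := hd.deriv.symm.trans h0
    linarith
  have hsum : ∑ i, ((rowSum C S i - (rowSum C S i)ᵀ)ᵀ
      * (rowSum C S i - (rowSum C S i)ᵀ)).trace = 0 := by
    have : l (leftTrans S Z) = ∑ i, ((rowSum C S i)ᵀ * leftTrans S Z i).trace := rfl
    rw [hl, hZ] at this
    simp only [← trace_mul_sub_transpose, ← Finset.mul_sum, ← this, mul_zero]
  rw [Finset.sum_eq_zero_iff_of_nonneg fun i _ => trace_transpose_mul_self_nonneg _] at hsum
  exact (sub_eq_zero.1 (eq_zero_of_trace_transpose_mul_self (hsum i (Finset.mem_univ i)))).symm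

/-- At a critical point the Christoffel term vanishes, and the Hessian is twice the form of `L(S)`
on the left translates of the horizontal lifts. -/
theorem quotHess_eq (hC : Cᵀ = C) {S : OrthPow m d} (hS : IsCriticalAt (quotCost C) S)
    (U V : horizontalSp S) :
    quotHess (quotCost C) S U V = 2 * traceForm (matL C S) (leftTrans S U) (leftTrans S V) := by
  have hc := rowSum_symm_of_isCriticalAt hC hS
  have hfirst : ∀ Z : horizontalSp S, lineDeriv ℝ (inCoords (quotCost C) S) Z V
      = 2 * traceForm (matL C S) (expSub (leftTrans S Z))
        (fderiv ℝ expSub (leftTrans S Z) (leftTrans S V)) := by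
    intro Z
    have h := (hasDerivAt_quadratic_expSub (traceForm (matL C S)) (leftTrans S Z)
      (leftTrans S V)).const_add (cost C S)
    rw [lineDeriv, show (fun t : ℝ => inCoords (quotCost C) S (Z + t • V)) = _ from
      funext fun t => inCoords_eq_of_rowSum_symm hC hc (Z + t • V)]
    simp only [Submodule.coe_add, Submodule.coe_smul, map_add, map_smul]
    rw [h.deriv, traceForm_comm (matL_transpose hC hc) (fderiv ℝ expSub _ _)]
    ring
  rw [quotHess, coordHess, hS, sub_zero]
  simp only [hfirst]
  rw [lineDeriv]
  simp only [zero_add, Submodule.coe_smul, map_smul]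
  exact ((hasDerivAt_deriv_quadratic_expSub _ _ _).const_mul 2).deriv

/-! ### Necessity: the Hessian at a local minimum -/

theorem continuous_proj : Continuous (proj : OrthPow m d → AlignSpace m d) :=
  continuous_quotient_mk'

theorem continuous_expMap_smul (S : OrthPow m d) (Z : horizontalSp S) :
    Continuous fun t : ℝ => expMap S (t • Z) := by
  refine continuous_pi fun i => continuous_const.mul (Continuous.subtype_mk ?_ _)
  have h : Continuous (NormedSpace.exp : Matrix (Fin d) (Fin d) ℝ → _) :=
    NormedSpace.exp_continuous
  refine h.comp ?_
  have : (fun t : ℝ => (blocks S i)ᵀ * (t • Z).1 i)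
      = fun t : ℝ => t • ((blocks S i)ᵀ * Z.1 i) := by
    funext t
    simp
  rw [this]
  exact continuous_id.smul continuous_const

theorem expMap_zero (S : OrthPow m d) : expMap S 0 = S := by
  funext i
  apply Subtype.ext
  simp [expMap]

theorem traceForm_nonneg_of_isLocalMin (hC : Cᵀ = C) {S : OrthPow m d}
    (hc : ∀ i, (rowSum C S i)ᵀ = rowSum C S i) (hmin : IsLocalMin (quotCost C) (proj S))
    {Ω : Fin m → Matrix (Fin d) (Fin d) ℝ} (hΩ : Ω ∈ skewZero m d) :
    0 ≤ traceForm (matL C S) Ω Ω := by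
  obtain ⟨Z, hZ⟩ := exists_leftTrans_eq (S := S) hΩ
  have hcont : Continuous fun t : ℝ => proj (expMap S (t • Z)) :=
    continuous_proj.comp (continuous_expMap_smul S Z)
  have h0 : proj (expMap S ((0 : ℝ) • Z)) = proj S := by rw [zero_smul, expMap_zero]
  have hev : ∀ᶠ t : ℝ in 𝓝 0, 0 ≤ traceForm (matL C S) (expSub (t • Ω)) (expSub (t • Ω)) := by
    have ht := hcont.tendsto 0
    simp only [h0] at ht
    filter_upwards [ht.eventually hmin] with t h
    have h' : cost C S ≤ inCoords (quotCost C) S (t • Z) := h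
    rw [inCoords_eq_of_rowSum_symm hC hc, Submodule.coe_smul, map_smul, hZ] at h'
    linarith
  have hslope := hasDerivAt_iff_tendsto_slope_zero.1 (hasDerivAt_expSub_smul Ω)
  simp only [zero_add, zero_smul, expSub_zero, sub_zero] at hslope
  have hB : Continuous fun X : Fin m → Matrix (Fin d) (Fin d) ℝ => traceForm (matL C S) X X :=
    (traceForm (matL C S)).toContinuousBilinearMap.continuous.clm_apply continuous_id
  refine ge_of_tendsto ((hB.tendsto Ω).comp hslope) ?_
  filter_upwards [hev.filter_mono nhdsWithin_le_nhds] with t ht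
  simp only [Function.comp_apply, map_smul, LinearMap.smul_apply, smul_eq_mul]
  rw [← mul_assoc]
  exact mul_nonneg (mul_self_nonneg _) ht

/-! ### Sufficiency: alignment of nearby configurations -/

theorem frobenius_norm_sq (A : Matrix (Fin d) (Fin d) ℝ) : ‖A‖ ^ 2 = (Aᵀ * A).trace := by
  rw [Matrix.frobenius_norm_def, ← Real.sqrt_eq_rpow, Real.sq_sqrt (by positivity),
    Finset.sum_comm]
  simp [Matrix.trace, Matrix.mul_apply, pow_two]

theorem isCompact_orthogonalGroup :
    IsCompact (Set.univ : Set (Matrix.orthogonalGroup (Fin d) ℝ)) := by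
  rw [← isCompact_iff_isCompact_univ (s := (Matrix.orthogonalGroup (Fin d) ℝ :
    Set (Matrix (Fin d) (Fin d) ℝ)))]
  have hK : IsCompact (Set.univ.pi fun _ => Set.univ.pi fun _ => Set.Icc (-1) 1 :
      Set (Fin d → Fin d → ℝ)) :=
    isCompact_univ_pi fun _ => isCompact_univ_pi fun _ => isCompact_Icc
  refine IsCompact.of_isClosed_subset hK ?_ ?_
  · have : (Matrix.orthogonalGroup (Fin d) ℝ : Set (Matrix (Fin d) (Fin d) ℝ))
        = {A | A * Aᵀ = 1} := by
      ext A
      exact Matrix.mem_orthogonalGroup_iff (Fin d) ℝ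
    rw [this]
    exact isClosed_eq (continuous_id.matrix_mul continuous_id.matrix_transpose) continuous_const
  · intro A hA i _ j _
    exact abs_le.1 (entry_norm_bound_of_unitary hA i j)

/-- The orthogonal polar factor, found as a maximizer `Q` of `Tr(M Q)` over the orthogonal group:
stationarity along `Q exp(tK)`, for skew `K`, makes `M Q` symmetric. -/
theorem exists_orthogonal_mul_symm (M : Matrix (Fin d) (Fin d) ℝ) :
    ∃ Q : Matrix.orthogonalGroup (Fin d) ℝ,
      (M * (Q : Matrix (Fin d) (Fin d) ℝ))ᵀ = M * Q ∧ M.trace ≤ (M * Q).trace := by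
  have hcont : Continuous fun Q : Matrix.orthogonalGroup (Fin d) ℝ =>
      (M * (Q : Matrix (Fin d) (Fin d) ℝ)).trace :=
    (continuous_const.matrix_mul continuous_subtype_val).matrix_trace
  obtain ⟨Q, -, hQ⟩ := isCompact_orthogonalGroup.exists_isMaxOn ⟨1, Set.mem_univ _⟩
    hcont.continuousOn
  have hmax : ∀ Q' : Matrix.orthogonalGroup (Fin d) ℝ,
      (M * (Q' : Matrix (Fin d) (Fin d) ℝ)).trace ≤ (M * Q).trace :=
    fun Q' => hQ (Set.mem_univ Q')
  refine ⟨Q, ?_, by simpa using hmax 1⟩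
  obtain ⟨N, hN⟩ : ∃ N, M * (Q : Matrix (Fin d) (Fin d) ℝ) = N := ⟨_, rfl⟩
  have hK : (Nᵀ - N)ᵀ = -(Nᵀ - N) := by simp
  have hder : HasDerivAt (fun t : ℝ => (N * NormedSpace.exp (t • (Nᵀ - N))).trace)
      (N * (Nᵀ - N)).trace 0 := by
    have h1 : HasDerivAt (fun t : ℝ => NormedSpace.exp (t • (Nᵀ - N))) (Nᵀ - N) 0 := by
      have := hasDerivAt_exp_smul_const (𝕂 := ℝ) (Nᵀ - N) (0 : ℝ)
      simp only [zero_smul, NormedSpace.exp_zero, one_mul] at this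
      exact this
    let l : Matrix (Fin d) (Fin d) ℝ →ₗ[ℝ] ℝ :=
      (Matrix.traceLinearMap (Fin d) ℝ ℝ).comp (LinearMap.mulLeft ℝ N)
    exact (l.toContinuousLinearMap.hasFDerivAt.comp_hasDerivAt (0 : ℝ) h1 :)
  have hloc : IsLocalMax (fun t : ℝ => (N * NormedSpace.exp (t • (Nᵀ - N))).trace) 0 := by
    refine Eventually.of_forall fun t => ?_
    have hsk : (t • (Nᵀ - N))ᵀ = -(t • (Nᵀ - N)) := by
      rw [transpose_smul, hK, smul_neg]
    have h := hmax (Q * ⟨_, exp_mem_orthogonalGroup hsk⟩)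
    simp only [zero_smul, NormedSpace.exp_zero, Matrix.mul_one]
    rw [← hN]
    rw [hN] at h ⊢
    simpa [← Matrix.mul_assoc, hN] using h
  have h0 := hloc.hasDerivAt_eq_zero hder
  have h1 := trace_mul_sub_transpose Nᵀ
  rw [transpose_transpose, h0, mul_zero] at h1
  rw [hN]
  exact sub_eq_zero.1 (eq_zero_of_trace_transpose_mul_self h1.symm)

/-- A bilinear form on a finite-dimensional space that is positive on a subspace is coercive
there. -/
theorem exists_coercive_on_submodule {V : Type*} [NormedAddCommGroup V] [NormedSpace ℝ V]
    [FiniteDimensional ℝ V] (B : V →ₗ[ℝ] V →ₗ[ℝ] ℝ) (W : Submodule ℝ V)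
    (hpos : ∀ w ∈ W, w ≠ 0 → 0 < B w w) : ∃ c > 0, ∀ w ∈ W, c * ‖w‖ ^ 2 ≤ B w w := by
  have := FiniteDimensional.proper ℝ V
  have hB : Continuous fun X : V => B X X :=
    B.toContinuousBilinearMap.continuous.clm_apply continuous_id
  have hK : IsCompact (Metric.sphere (0 : V) 1 ∩ W) :=
    (isCompact_sphere 0 1).inter_right W.closed_of_finiteDimensional
  have hc : ∃ c > 0, ∀ w ∈ W, ‖w‖ = 1 → c ≤ B w w := by
    rcases (Metric.sphere (0 : V) 1 ∩ W).eq_empty_or_nonempty with he | hne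
    · refine ⟨1, one_pos, fun w hw h1 => ?_⟩
      have : w ∈ Metric.sphere (0 : V) 1 ∩ W := ⟨by simpa using h1, hw⟩
      simp [he] at this
    · obtain ⟨v, ⟨hv1, hv⟩, hmin⟩ := hK.exists_isMinOn hne hB.continuousOn
      have hv1' : ‖v‖ = 1 := by simpa using hv1
      refine ⟨B v v, hpos v hv ?_, fun w hw h1 => hmin ⟨by simpa using h1, hw⟩⟩
      rintro rfl
      simp at hv1'
  obtain ⟨c, hc0, hc⟩ := hc
  refine ⟨c, hc0, fun w hw => ?_⟩
  rcases eq_or_ne w 0 with rfl | hw0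
  · simp
  have hn : ‖w‖ ≠ 0 := norm_ne_zero_iff.2 hw0
  have h := hc (‖w‖⁻¹ • w) (W.smul_mem _ hw) (by rw [norm_smul]; simp [hn])
  simp only [map_smul, LinearMap.smul_apply, smul_eq_mul] at h
  calc c * ‖w‖ ^ 2 ≤ ‖w‖⁻¹ * (‖w‖⁻¹ * B w w) * ‖w‖ ^ 2 := by gcongr
    _ = B w w := by field_simp

theorem exists_bilin_bound {V : Type*} [NormedAddCommGroup V] [NormedSpace ℝ V]
    [FiniteDimensional ℝ V] (B : V →ₗ[ℝ] V →ₗ[ℝ] ℝ) :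
    ∃ K > 0, ∀ X Y, |B X Y| ≤ K * ‖X‖ * ‖Y‖ := by
  refine ⟨‖B.toContinuousBilinearMap‖ + 1, by positivity, fun X Y => ?_⟩
  calc |B X Y| ≤ ‖B.toContinuousBilinearMap‖ * ‖X‖ * ‖Y‖ :=
        B.toContinuousBilinearMap.le_opNorm₂ X Y
    _ ≤ _ := by gcongr; linarith

/-- If `x ≤ w + p` is small and `p` is of order `x²`, then `c w²` dominates `2 K w p + K p²`. -/
theorem quadratic_dominates {c K x w p : ℝ} (hK : 0 < K) (hx0 : 0 ≤ x) (hw0 : 0 ≤ w)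
    (hp0 : 0 ≤ p) (hx1 : x < 1) (hxK : x * (3 * K) ≤ c) (hxw : x ≤ w + p)
    (hp : p ≤ 1 / 2 * x ^ 2) : 0 ≤ c * w ^ 2 - 2 * (K * w * p) - K * p * p := by
  have hx2 : x ≤ 2 * w := by nlinarith
  have hpw : p ≤ x * w := by nlinarith
  have hpw' : p ≤ w := hpw.trans (mul_le_of_le_one_left hw0 hx1.le)
  have e4 : K * w * p ≤ K * w * (x * w) := by gcongr
  have e5 : K * p * p ≤ K * w * (x * w) := by gcongr
  have e6 : x * (3 * K) * w ^ 2 ≤ c * w ^ 2 := by gcongr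
  linarith

/-- A form that is positive on skew blocks of sum zero is nonnegative at `R - 1` for orthogonal
blocks `R_i` close to `1` with symmetric sum: up to second order, `R - 1` equals its skew part,
which has sum zero. -/
theorem exists_traceForm_nonneg {M : Matrix (Fin m × Fin d) (Fin m × Fin d) ℝ} (hM : Mᵀ = M)
    (hpos : ∀ Ω ∈ skewZero m d, Ω ≠ 0 → 0 < traceForm M Ω Ω) :
    ∃ ε > 0, ∀ R : OrthPow m d, (∑ i, blocks R i)ᵀ = ∑ i, blocks R i → ‖blocks R - 1‖ < ε →
      0 ≤ traceForm M (blocks R - 1) (blocks R - 1) := by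
  obtain ⟨c, hc0, hc⟩ := exists_coercive_on_submodule (traceForm M) (skewZero m d) hpos
  obtain ⟨K, hK0, hK⟩ := exists_bilin_bound (traceForm M)
  refine ⟨min 1 (c / (3 * K)), by positivity, fun R hR hε => ?_⟩
  obtain ⟨X, hX⟩ : ∃ X, blocks R - 1 = X := ⟨_, rfl⟩
  rw [hX] at hε ⊢
  obtain ⟨hX1, hXK⟩ := lt_min_iff.1 hε
  rw [lt_div_iff₀ (by positivity)] at hXK
  -- `Ω` and `P` are the skew and the symmetric part of `X`
  set Ω : Fin m → Matrix (Fin d) (Fin d) ℝ := fun i => (1 / 2 : ℝ) • (X i - (X i)ᵀ) with hΩdef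
  set P : Fin m → Matrix (Fin d) (Fin d) ℝ := fun i => (1 / 2 : ℝ) • (X i + (X i)ᵀ) with hPdef
  have hXsum : X = Ω + P := by
    funext i
    simp only [hΩdef, hPdef, Pi.add_apply, ← smul_add]
    rw [show X i - (X i)ᵀ + (X i + (X i)ᵀ) = (2 : ℝ) • X i by rw [two_smul]; abel, smul_smul]
    norm_num
  have hΩ : Ω ∈ skewZero m d := by
    refine ⟨fun i => by simp [hΩdef, ← smul_neg], ?_⟩
    have hs : (∑ i, X i)ᵀ = ∑ i, X i := by
      rw [← hX]
      simp only [Pi.sub_apply, Pi.one_apply, Finset.sum_sub_distrib, transpose_sub, hR]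
      simp
    simp only [hΩdef]
    rw [← Finset.smul_sum, Finset.sum_sub_distrib, ← Matrix.transpose_sum, hs, sub_self, smul_zero]
  have hP : ‖P‖ ≤ 1 / 2 * ‖X‖ ^ 2 := by
    refine (pi_norm_le_iff_of_nonneg (by positivity)).2 fun i => ?_
    have hi : P i = (1 / 2 : ℝ) • (-((X i)ᵀ * X i)) := by
      have := blocks_sub_one_transpose_mul R i
      rw [hX] at this
      rw [this, neg_neg]
    rw [hi, norm_smul, norm_neg, Real.norm_of_nonneg (by norm_num)]
    have h1 : ‖(X i)ᵀ * X i‖ ≤ ‖X i‖ * ‖X i‖ := by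
      have := Matrix.frobenius_norm_mul (X i)ᵀ (X i)
      rwa [Matrix.frobenius_norm_transpose] at this
    have h2 : ‖X i‖ ≤ ‖X‖ := norm_le_pi_norm X i
    have h3 : ‖X i‖ * ‖X i‖ ≤ ‖X‖ ^ 2 := by rw [pow_two]; gcongr
    linarith
  have hXΩ : ‖X‖ ≤ ‖Ω‖ + ‖P‖ := by
    conv_lhs => rw [hXsum]
    exact norm_add_le _ _
  have hdom := quadratic_dominates hK0 (norm_nonneg X) (norm_nonneg Ω) (norm_nonneg P) hX1 hXK.le
    hXΩ hP
  have e1 := hc Ω hΩ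
  have e2 := (abs_le.1 (hK Ω P)).1
  have e3 := (abs_le.1 (hK P P)).1
  rw [hXsum]
  simp only [map_add, LinearMap.add_apply]
  rw [traceForm_comm hM P Ω]
  linarith

/-- If the form of `L(S)` is positive on skew blocks of sum zero, then `S` is a local minimum: every
nearby `S'` is aligned with `S` by an orthogonal matrix as in `exists_orthogonal_mul_symm`, and the
cost of the aligned configuration is given by `cost_mul_of_rowSum_symm`. -/
theorem isLocalMin_of_pos (hC : Cᵀ = C) {S : OrthPow m d}
    (hc : ∀ i, (rowSum C S i)ᵀ = rowSum C S i)
    (hpos : ∀ Ω ∈ skewZero m d, Ω ≠ 0 → 0 < traceForm (matL C S) Ω Ω) :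
    IsLocalMin (quotCost C) (proj S) := by
  obtain ⟨ε, hε, hnn⟩ := exists_traceForm_nonneg (matL_transpose hC hc) hpos
  set U : Set (OrthPow m d) :=
    {S' | (m * d : ℝ) - ε ^ 2 / 2 < (∑ i, (blocks S i)ᵀ * blocks S' i).trace} with hU
  have hcont : Continuous fun S' : OrthPow m d => (∑ i, (blocks S i)ᵀ * blocks S' i).trace := by
    refine (continuous_finsetSum _ fun i _ => continuous_const.matrix_mul ?_).matrix_trace
    exact continuous_subtype_val.comp (continuous_apply i)
  have hUo : IsOpen U := isOpen_lt continuous_const hcont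
  have hSU : S ∈ U := by
    change (m * d : ℝ) - ε ^ 2 / 2 < (∑ i, (blocks S i)ᵀ * blocks S i).trace
    rw [trace_sum]
    simp only [blocks_transpose_mul, trace_one, Fintype.card_fin, Finset.sum_const,
      Finset.card_univ, nsmul_eq_mul]
    linarith [pow_pos hε 2]
  have hlow : ∀ S' ∈ U, cost C S ≤ cost C S' := by
    intro S' hS'
    obtain ⟨Q, hQ1, hQ2⟩ := exists_orthogonal_mul_symm (∑ i, (blocks S i)ᵀ * blocks S' i)
    let R : OrthPow m d := fun i => (S i)⁻¹ * (S' i * Q)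
    have hRb : ∀ i, blocks R i = (blocks S i)ᵀ * blocks S' i * Q := by
      intro i
      rw [Matrix.mul_assoc]
      rfl
    have hRsum : ∑ i, blocks R i
        = (∑ i, (blocks S i)ᵀ * blocks S' i) * (Q : Matrix (Fin d) (Fin d) ℝ) := by
      simp only [hRb, Finset.sum_mul]
    have hcost : cost C S' = cost C (fun i => S i * R i) :=
      cost_invariant C _ _ ⟨Q, fun i => by simp [R]⟩
    -- maximizing the trace of `∑ R_i` is minimizing the distance of `R` from `1`
    have hsum : ∑ i, ‖(blocks R - 1) i‖ ^ 2 = 2 * (m * d) - 2 * (∑ i, blocks R i).trace := by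
      simp only [frobenius_norm_sq, blocks_sub_one_transpose_mul]
      simp only [Pi.sub_apply, Pi.one_apply, trace_neg, trace_add, trace_transpose, trace_sub,
        trace_one, Fintype.card_fin, trace_sum, Finset.sum_neg_distrib, Finset.sum_add_distrib,
        Finset.sum_sub_distrib, Finset.sum_const, Finset.card_univ, nsmul_eq_mul]
      ring
    have hnorm : ‖blocks R - 1‖ < ε := by
      refine (pi_norm_lt_iff hε).2 fun i => ?_
      refine lt_of_pow_lt_pow_left₀ 2 hε.le ?_
      have h1 : ‖(blocks R - 1) i‖ ^ 2 ≤ ∑ i, ‖(blocks R - 1) i‖ ^ 2 :=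
        Finset.single_le_sum (f := fun i => ‖(blocks R - 1) i‖ ^ 2)
          (fun _ _ => by positivity) (Finset.mem_univ i)
      have h2 : (m * d : ℝ) - ε ^ 2 / 2 < _ := hS'
      rw [← hRsum] at hQ2
      linarith
    rw [hcost, cost_mul_of_rowSum_symm hC hc]
    have := hnn R (by rw [hRsum, hQ1]) hnorm
    linarith
  -- `π` is open: the saturation of `U` is a union of translates
  have hopen : IsOpen (proj '' U) := by
    refine isQuotientMap_quotient_mk'.isOpen_preimage.1 ?_
    have : (Quotient.mk (alignSetoid m d)) ⁻¹' (proj '' U)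
        = ⋃ Q : Matrix.orthogonalGroup (Fin d) ℝ, (fun S' i => S' i * Q) ⁻¹' U := by
      ext S'
      simp only [Set.mem_preimage, Set.mem_image, Set.mem_iUnion]
      constructor
      · rintro ⟨S'', h, he⟩
        obtain ⟨Q, hQ⟩ := Quotient.exact he.symm
        exact ⟨Q, by rwa [← funext hQ]⟩
      · rintro ⟨Q, hQ⟩
        exact ⟨_, hQ, (Quotient.sound (s := alignSetoid m d)
          (show S' ≈ fun i => S' i * Q from ⟨Q, fun i => rfl⟩)).symm⟩
    exact this ▸ isOpen_iUnion fun Q => hUo.preimage (by fun_prop)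
  filter_upwards [hopen.mem_nhds (Set.mem_image_of_mem proj hSU)]
  rintro _ ⟨S', hS', rfl⟩
  exact hlow S' hS'

end Analysis

/-! ### Symmetric matrices that annihilate constant families -/

section ConstKernel

variable {τ : Type*}

/-- The constant family `[v, …, v]`. -/
def constFamily (m : ℕ) (τ : Type*) : (τ → ℝ) →ₗ[ℝ] (Fin m × τ → ℝ) where
  toFun v := fun p => v p.2
  map_add' _ _ := rfl
  map_smul' _ _ := rfl

theorem constFamily_injective (hm : 0 < m) : Function.Injective (constFamily m τ) := by
  intro v w h
  funext a
  exact congrFun h (⟨0, hm⟩, a)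

theorem mem_range_constFamily (hm : 0 < m) {ω : Fin m × τ → ℝ} :
    ω ∈ LinearMap.range (constFamily m τ) ↔ ∀ i j a, ω (i, a) = ω (j, a) := by
  constructor
  · rintro ⟨v, rfl⟩ i j a
    rfl
  · intro h
    exact ⟨fun a => ω (⟨0, hm⟩, a), funext fun p => h _ _ _⟩

variable [Fintype τ]

theorem finrank_range_constFamily (hm : 0 < m) :
    Module.finrank ℝ (LinearMap.range (constFamily m τ)) = Fintype.card τ := by
  rw [LinearMap.finrank_range_of_inj (constFamily_injective hm), Module.finrank_fintype_fun_eq_card]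

variable {A : Matrix (Fin m × τ) (Fin m × τ) ℝ}

theorem rank_add_finrank_ker (A : Matrix (Fin m × τ) (Fin m × τ) ℝ) :
    A.rank + Module.finrank ℝ (LinearMap.ker A.mulVecLin) = m * Fintype.card τ := by
  rw [Matrix.rank, LinearMap.finrank_range_add_finrank_ker, Module.finrank_fintype_fun_eq_card,
    Fintype.card_prod, Fintype.card_fin]

theorem range_constFamily_le_ker (hA : ∀ v, A *ᵥ constFamily m τ v = 0) :
    LinearMap.range (constFamily m τ) ≤ LinearMap.ker A.mulVecLin := by
  rintro _ ⟨v, rfl⟩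
  exact hA v

theorem card_le_finrank_ker (hm : 0 < m) (hA : ∀ v, A *ᵥ constFamily m τ v = 0) :
    Fintype.card τ ≤ Module.finrank ℝ (LinearMap.ker A.mulVecLin) := by
  rw [← finrank_range_constFamily hm]
  exact Submodule.finrank_mono (range_constFamily_le_ker hA)

theorem rank_le_of_const_mem_ker (hm : 0 < m) (hA : ∀ v, A *ᵥ constFamily m τ v = 0) :
    A.rank ≤ (m - 1) * Fintype.card τ := by
  have h1 := rank_add_finrank_ker A
  have h2 := card_le_finrank_ker hm hA
  rw [Nat.sub_mul, one_mul]
  omega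

/-- A symmetric form that vanishes on constant families is positive on all others exactly if it is
positive semidefinite with no further kernel. -/
theorem pos_iff_posSemidef_and_rank (hm : 0 < m) (hH : A.IsHermitian)
    (hA : ∀ v, A *ᵥ constFamily m τ v = 0) :
    (∀ ω : Fin m × τ → ℝ, (∃ i j a, ω (i, a) ≠ ω (j, a)) → 0 < ω ⬝ᵥ (A *ᵥ ω)) ↔
      A.PosSemidef ∧ A.rank = (m - 1) * Fintype.card τ := by
  have hdim := rank_add_finrank_ker A
  have hle := Nat.le_mul_of_pos_left (Fintype.card τ) hm
  constructor
  · intro h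
    have hker : LinearMap.ker A.mulVecLin = LinearMap.range (constFamily m τ) := by
      refine le_antisymm (fun ω hω => ?_) (range_constFamily_le_ker hA)
      rw [mem_range_constFamily hm]
      by_contra! hne
      have hω0 : A *ᵥ ω = 0 := hω
      have := h ω hne
      rw [hω0, dotProduct_zero] at this
      exact lt_irrefl _ this
    refine ⟨PosSemidef.of_dotProduct_mulVec_nonneg hH fun ω => ?_, ?_⟩
    · rw [star_trivial]
      by_cases hne : ∃ i j a, ω (i, a) ≠ ω (j, a)
      · exact (h ω hne).le
      · push Not at hne
        obtain ⟨v, rfl⟩ := (mem_range_constFamily hm).2 hne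
        rw [hA, dotProduct_zero]
    · rw [hker, finrank_range_constFamily hm] at hdim
      rw [Nat.sub_mul, one_mul]
      omega
  · rintro ⟨hpsd, hrank⟩ ω ⟨i, j, a, hne⟩
    rw [hrank, Nat.sub_mul, one_mul] at hdim
    have hker : LinearMap.range (constFamily m τ) = LinearMap.ker A.mulVecLin := by
      refine Submodule.eq_of_le_of_finrank_eq (range_constFamily_le_ker hA) ?_
      rw [finrank_range_constFamily hm]
      omega
    have h0 := hpsd.dotProduct_mulVec_nonneg ω
    have h1 := hpsd.dotProduct_mulVec_zero_iff ω
    rw [star_trivial] at h0 h1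
    refine lt_of_le_of_ne h0 fun he => hne ?_
    have hmem : ω ∈ LinearMap.ker A.mulVecLin := h1.1 he.symm
    rw [← hker, mem_range_constFamily hm] at hmem
    exact hmem i j a

/-- The rank of a symmetric matrix is the number of nonzero entries in the sorted list of its
eigenvalues. -/
theorem rank_eq_card_eigenvalues₀_ne_zero {ι : Type*} [Fintype ι] [DecidableEq ι]
    {A : Matrix ι ι ℝ} (hH : A.IsHermitian) :
    A.rank = (Finset.univ.filter fun k => hH.eigenvalues₀ k ≠ 0).card := by
  rw [hH.rank_eq_card_non_zero_eigs, ← Fintype.card_subtype]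
  exact Fintype.card_congr
    ((Fintype.equivOfCardEq (Fintype.card_fin _)).symm.subtypeEquiv fun i => Iff.rfl)

/-- As the constant families account for `card τ` zero eigenvalues, semidefiniteness and full
remaining rank together say that the next eigenvalue is positive. -/
theorem posSemidef_and_rank_iff_eigenvalue_pos [DecidableEq τ] (hm : 0 < m) (hH : A.IsHermitian)
    (hA : ∀ v, A *ᵥ constFamily m τ v = 0) :
    (A.PosSemidef ∧ A.rank = (m - 1) * Fintype.card τ) ↔
      ∀ h : Fintype.card τ < Fintype.card (Fin m × τ),
        0 < hH.eigenvalues₀ (Fin.rev ⟨Fintype.card τ, h⟩) := by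
  have hcard : (m - 1) * Fintype.card τ = Fintype.card (Fin m × τ) - Fintype.card τ := by
    rw [Fintype.card_prod, Fintype.card_fin, Nat.sub_mul, one_mul]
  have hrank := rank_eq_card_eigenvalues₀_ne_zero hH
  have hanti := hH.eigenvalues₀_antitone
  constructor
  · rintro ⟨hpsd, hr⟩ h
    by_contra hneg
    have hnn : ∀ k, 0 ≤ hH.eigenvalues₀ k := fun k => by
      have := hpsd.eigenvalues_nonneg (Fintype.equivOfCardEq (Fintype.card_fin _) k)
      simpa [IsHermitian.eigenvalues] using this
    -- all nonzero eigenvalues come strictly before this one in the antitone list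
    have hsub : (Finset.univ.filter fun k => hH.eigenvalues₀ k ≠ 0)
        ⊆ Finset.Iio (Fin.rev ⟨Fintype.card τ, h⟩) := by
      intro k hk
      rw [Finset.mem_Iio]
      by_contra hle
      exact (Finset.mem_filter.1 hk).2
        (le_antisymm ((hanti (not_lt.1 hle)).trans (not_lt.1 hneg)) (hnn k))
    have := Finset.card_le_card hsub
    rw [← hrank, hr, hcard, Fin.card_Iio, Fin.val_rev] at this
    simp only at this
    omega
  · intro hpos
    have hlarge : (m - 1) * Fintype.card τ
        ≤ (Finset.univ.filter fun k => 0 < hH.eigenvalues₀ k).card := by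
      by_cases h : Fintype.card τ < Fintype.card (Fin m × τ)
      · have hsub : Finset.Iic (Fin.rev ⟨Fintype.card τ, h⟩)
            ⊆ Finset.univ.filter fun k => 0 < hH.eigenvalues₀ k := fun k hk =>
          Finset.mem_filter.2 ⟨Finset.mem_univ _, (hpos h).trans_le (hanti (Finset.mem_Iic.1 hk))⟩
        have := Finset.card_le_card hsub
        rw [Fin.card_Iic, Fin.val_rev] at this
        simp only at this
        omega
      · omega
    have hrle := rank_le_of_const_mem_ker hm hA
    have hsub : (Finset.univ.filter fun k => 0 < hH.eigenvalues₀ k)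
        ⊆ Finset.univ.filter fun k => hH.eigenvalues₀ k ≠ 0 :=
      Finset.monotone_filter_right _ fun k _ hk => ne_of_gt hk
    have hle := Finset.card_le_card hsub
    have heq := Finset.eq_of_subset_of_card_le hsub (by omega)
    refine ⟨hH.posSemidef_iff_eigenvalues_nonneg.2 fun i => ?_, by omega⟩
    by_contra hneg
    have hmem : (Fintype.equivOfCardEq (Fintype.card_fin _)).symm i ∈
        Finset.univ.filter fun k => hH.eigenvalues₀ k ≠ 0 :=
      Finset.mem_filter.2 ⟨Finset.mem_univ _, fun h0 => hneg (le_of_eq h0.symm)⟩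
    rw [← heq] at hmem
    exact hneg (Finset.mem_filter.1 hmem).2.le

end ConstKernel

/-! ### Skew-symmetric coordinates -/

theorem card_lowerPos (d : ℕ) : Fintype.card (LowerPos d) = d * (d - 1) / 2 := by
  rw [Fintype.card_congr (Equiv.subtypeProdEquivSigmaSubtype fun r c : Fin d => c < r),
    Fintype.card_sigma, ← Finset.sum_range_id, Finset.sum_range]
  refine Finset.sum_congr rfl fun r _ => ?_
  rw [Fintype.card_subtype, Finset.filter_gt_eq_Iio, Fin.card_Iio]

theorem skewOf_transpose (ω : LowerPos d → ℝ) : (skewOf ω)ᵀ = -skewOf ω := by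
  ext r c
  rcases lt_trichotomy r c with h | rfl | h
  · simp [skewOf, h, h.not_gt]
  · simp [skewOf]
  · simp [skewOf, h, h.not_gt]

theorem skewOf_apply_of_lt (ω : LowerPos d → ℝ) (a : LowerPos d) :
    skewOf ω a.1.1 a.1.2 = ω a := by
  simp [skewOf, a.2]

theorem skewOf_injective : Function.Injective (skewOf : (LowerPos d → ℝ) → _) := by
  intro ω ω' h
  funext a
  rw [← skewOf_apply_of_lt ω, h, skewOf_apply_of_lt]

theorem exists_skewOf_eq {Ω : Matrix (Fin d) (Fin d) ℝ} (h : Ωᵀ = -Ω) :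
    ∃ ω : LowerPos d → ℝ, skewOf ω = Ω := by
  refine ⟨fun a => Ω a.1.1 a.1.2, ?_⟩
  have hs : ∀ r c, Ω c r = -Ω r c := fun r c => congrFun (congrFun h r) c
  ext r c
  rcases lt_trichotomy r c with hlt | rfl | hlt
  · simp [skewOf, hlt, hlt.not_gt, hs r c]
  · simp only [skewOf, Matrix.of_apply, lt_irrefl, dite_false]
    linarith [hs r r]
  · simp [skewOf, hlt]

theorem exists_skewBlocks_eq {Ω : Fin m → Matrix (Fin d) (Fin d) ℝ} (h : ∀ i, (Ω i)ᵀ = -Ω i) :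
    ∃ ω : Fin m × LowerPos d → ℝ, skewBlocks ω = Ω := by
  choose f hf using fun i => exists_skewOf_eq (h i)
  exact ⟨fun p => f p.1 p.2, funext hf⟩

theorem skewBlocks_ne_iff (ω : Fin m × LowerPos d → ℝ) :
    (∃ i j, skewBlocks ω i ≠ skewBlocks ω j) ↔ ∃ i j a, ω (i, a) ≠ ω (j, a) := by
  refine exists_congr fun i => exists_congr fun j => ?_
  rw [← Function.ne_iff (f₁ := fun a => ω (i, a)) (f₂ := fun a => ω (j, a))]
  exact skewOf_injective.ne_iff

theorem matLL_mulVec (S : OrthPow m d) (ω : Fin m × LowerPos d → ℝ) :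
    matLL C S *ᵥ ω = (skewVec m d)ᵀ *ᵥ Matrix.vec (matL C S * stack (skewBlocks ω)) := by
  rw [matLL, ← Matrix.mulVec_mulVec, ← Matrix.mulVec_mulVec, skewVec_mulVec,
    Matrix.kronecker_mulVec_vec, transpose_one, Matrix.mul_one]

theorem dotProduct_matLL_mulVec (S : OrthPow m d) (ω : Fin m × LowerPos d → ℝ) :
    ω ⬝ᵥ (matLL C S *ᵥ ω) = traceForm (matL C S) (skewBlocks ω) (skewBlocks ω) := by
  rw [matLL_mulVec, Matrix.dotProduct_mulVec, Matrix.vecMul_transpose, skewVec_mulVec,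
    Matrix.vec_dotProduct_vec, traceForm_apply, Matrix.mul_assoc]

theorem matLL_isHermitian {S : OrthPow m d} (hL : (matL C S)ᵀ = matL C S) :
    (matLL C S).IsHermitian := by
  rw [Matrix.IsHermitian, Matrix.conjTranspose_eq_transpose_of_trivial, matLL]
  simp only [Matrix.transpose_mul, transpose_transpose, Matrix.mul_assoc]
  rw [← Matrix.kroneckerMap_transpose, transpose_one, hL]

theorem matLL_mulVec_constFamily (S : OrthPow m d) (v : LowerPos d → ℝ) :
    matLL C S *ᵥ constFamily m (LowerPos d) v = 0 := by
  have h : skewBlocks (constFamily m (LowerPos d) v) = fun _ : Fin m => skewOf v := rfl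
  rw [matLL_mulVec, h, matL_mul_stack_const, Matrix.vec_zero, Matrix.mulVec_zero]

/-! ### The equivalences -/

theorem traceForm_sub_const {S : OrthPow m d} (hL : (matL C S)ᵀ = matL C S)
    (Ω : Fin m → Matrix (Fin d) (Fin d) ℝ) (K : Matrix (Fin d) (Fin d) ℝ) :
    traceForm (matL C S) (Ω - fun _ => K) (Ω - fun _ => K) = traceForm (matL C S) Ω Ω := by
  have h : ∀ X, traceForm (matL C S) X (fun _ => K) = 0 := fun X => by
    rw [traceForm_apply, Matrix.mul_assoc, matL_mul_stack_const, Matrix.mul_zero,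
      Matrix.trace_zero]
  simp only [map_sub, LinearMap.sub_apply, h, traceForm_comm hL (fun _ => K), sub_zero]

/-- `L(S)` annihilates equal blocks, so that subtracting the mean reduces skew blocks that are not
all equal to nonzero skew blocks of sum zero. -/
theorem pos_on_skewZero_iff (hm : 0 < m) {S : OrthPow m d} (hL : (matL C S)ᵀ = matL C S) :
    (∀ Ω ∈ skewZero m d, Ω ≠ 0 → 0 < traceForm (matL C S) Ω Ω) ↔
      ∀ Ω : Fin m → Matrix (Fin d) (Fin d) ℝ, (∀ i, (Ω i)ᵀ = -Ω i) → (∃ i j, Ω i ≠ Ω j) →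
        0 < traceForm (matL C S) Ω Ω := by
  have hm' : (m : ℝ) ≠ 0 := by positivity
  constructor
  · rintro h Ω hΩ ⟨i, j, hij⟩
    rw [← traceForm_sub_const hL Ω ((m : ℝ)⁻¹ • ∑ i, Ω i)]
    refine h _ ⟨fun k => ?_, ?_⟩ fun h0 => hij ?_
    · have : (∑ i, Ω i)ᵀ = -∑ i, Ω i := by
        rw [Matrix.transpose_sum, ← Finset.sum_neg_distrib]
        exact Finset.sum_congr rfl fun i _ => hΩ i
      rw [Pi.sub_apply, transpose_sub, transpose_smul, hΩ, this, smul_neg]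
      abel
    · simp only [Pi.sub_apply, Finset.sum_sub_distrib, Finset.sum_const, Finset.card_univ,
        Fintype.card_fin]
      rw [← Nat.cast_smul_eq_nsmul ℝ, smul_smul, mul_inv_cancel₀ hm', one_smul, sub_self]
    · rw [sub_eq_zero] at h0
      rw [h0]
  · rintro h Ω ⟨hΩ, hsum⟩ hne
    refine h Ω hΩ ?_
    by_contra! heq
    refine hne (funext fun i => ?_)
    have h1 : ∑ j, Ω j = (m : ℝ) • Ω i := by
      rw [Finset.sum_congr rfl fun j _ => heq j i, Finset.sum_const, Finset.card_univ,
        Fintype.card_fin, Nat.cast_smul_eq_nsmul]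
    rw [hsum] at h1
    exact (smul_eq_zero.1 h1.symm).resolve_left hm'

/-- Positivity of the Hessian in terms of the form of `L(S)`. -/
theorem quotHess_pos_iff (hC : Cᵀ = C) {S : OrthPow m d} (hS : IsCriticalAt (quotCost C) S) :
    (∀ Z : horizontalSp S, Z ≠ 0 → 0 < quotHess (quotCost C) S Z Z) ↔
      ∀ Ω ∈ skewZero m d, Ω ≠ 0 → 0 < traceForm (matL C S) Ω Ω := by
  simp only [quotHess_eq hC hS]
  constructor
  · intro h Ω hΩ hne
    obtain ⟨Z, rfl⟩ := exists_leftTrans_eq (S := S) hΩ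
    have := h Z (by rintro rfl; simp at hne)
    linarith
  · intro h Z hZ
    have := h _ (leftTrans_mem_skewZero Z.2) fun h0 =>
      hZ (Subtype.ext (leftTrans_injective S (h0.trans (map_zero _).symm)))
    linarith

/-- For a semidefinite form with `B(Z, Z) = 0`, applied to `a = B(Z, V)` and `b = B(V, V)`, this
shows that `Z` is in the kernel of the form. -/
theorem eq_zero_of_quadratic_nonneg {a b : ℝ} (h : ∀ t : ℝ, 0 ≤ 2 * t * a + t ^ 2 * b) :
    a = 0 := by
  by_contra ha
  have hb := h (-a / (b ^ 2 + 1))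
  have : 2 * (-a / (b ^ 2 + 1)) * a + (-a / (b ^ 2 + 1)) ^ 2 * b
      = a ^ 2 * (b - 2 * (b ^ 2 + 1)) / (b ^ 2 + 1) ^ 2 := by
    field_simp
    ring
  rw [this] at hb
  refine hb.not_gt (div_neg_of_neg_of_pos (mul_neg_of_pos_of_neg (by positivity) ?_)
    (by positivity))
  nlinarith [sq_nonneg (4 * b - 1)]

theorem isNondegLocalMin_iff (hC : Cᵀ = C) {S : OrthPow m d}
    (hS : IsCriticalAt (quotCost C) S) :
    IsNondegLocalMin (quotCost C) S ↔
      ∀ Z : horizontalSp S, Z ≠ 0 → 0 < quotHess (quotCost C) S Z Z := by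
  have hc := rowSum_symm_of_isCriticalAt hC hS
  have hL := matL_transpose hC hc
  constructor
  · rintro ⟨hmin, hnd⟩ Z hZ
    have hnn : ∀ Ω ∈ skewZero m d, 0 ≤ traceForm (matL C S) Ω Ω := fun Ω hΩ =>
      traceForm_nonneg_of_isLocalMin hC hc hmin hΩ
    have hZ0 := hnn _ (leftTrans_mem_skewZero Z.2)
    rw [quotHess_eq hC hS]
    refine mul_pos two_pos (lt_of_le_of_ne hZ0 fun he => hZ (hnd Z fun V => ?_))
    rw [quotHess_eq hC hS, eq_zero_of_quadratic_nonneg (a := traceForm (matL C S) (leftTrans S Z)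
      (leftTrans S V)) (b := traceForm (matL C S) (leftTrans S V) (leftTrans S V)), mul_zero]
    intro t
    have ht := hnn _ ((skewZero m d).add_mem (leftTrans_mem_skewZero Z.2)
      ((skewZero m d).smul_mem t (leftTrans_mem_skewZero V.2)))
    simp only [map_add, map_smul, LinearMap.add_apply, LinearMap.smul_apply, smul_eq_mul, ← he,
      traceForm_comm hL (leftTrans S V) (leftTrans S Z)] at ht
    linarith
  · intro h
    refine ⟨isLocalMin_of_pos hC hc ((quotHess_pos_iff hC hS).1 h), fun U hU => ?_⟩
    by_contra hne
    exact (h U hne).ne' (hU U)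

end Procrustes

end

open Procrustes

theorem mainTheorem1 (n m d : ℕ) (hm : 0 < m) (hd : 0 < d)
    (E : Finset (Fin n × Fin m)) (x : Fin n → Fin m → Fin d → ℝ)
    (S : Procrustes.OrthPow m d)
    (hS : Procrustes.IsCriticalAt (Procrustes.quotCost (Procrustes.matC E x)) S) :
    List.TFAE [
      Procrustes.IsNondegLocalMin (Procrustes.quotCost (Procrustes.matC E x)) S,
      ∀ Z : Procrustes.horizontalSp S, Z ≠ 0 →
        0 < Procrustes.quotHess (Procrustes.quotCost (Procrustes.matC E x)) S Z Z,
      ∀ Ω : Fin m → Matrix (Fin d) (Fin d) ℝ, (∀ i, (Ω i)ᵀ = -Ω i) → ∑ i, Ω i = 0 → Ω ≠ 0 →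
        0 < ((Procrustes.stack Ω)ᵀ * Procrustes.matL (Procrustes.matC E x) S *
          Procrustes.stack Ω).trace,
      ∀ Ω : Fin m → Matrix (Fin d) (Fin d) ℝ, (∀ i, (Ω i)ᵀ = -Ω i) → (∃ i j, Ω i ≠ Ω j) →
        0 < ((Procrustes.stack Ω)ᵀ * Procrustes.matL (Procrustes.matC E x) S *
          Procrustes.stack Ω).trace,
      ∀ ω : Fin m × Procrustes.LowerPos d → ℝ, (∃ i j a, ω (i, a) ≠ ω (j, a)) →
        0 < ω ⬝ᵥ (Procrustes.matLL (Procrustes.matC E x) S *ᵥ ω),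
      (Procrustes.matLL (Procrustes.matC E x) S).PosSemidef ∧
        (Procrustes.matLL (Procrustes.matC E x) S).rank = (m - 1) * (d * (d - 1) / 2),
      -- The `(d(d-1)/2 + 1)`th smallest eigenvalue, if there are that many, is positive.
      ∃ hH : (Procrustes.matLL (Procrustes.matC E x) S).IsHermitian,
        ∀ h : d * (d - 1) / 2 < Fintype.card (Fin m × Procrustes.LowerPos d),
          0 < hH.eigenvalues₀ (Fin.rev ⟨d * (d - 1) / 2, h⟩)] := by
  have hC := matC_transpose E x
  have hL := matL_transpose hC (rowSum_symm_of_isCriticalAt hC hS)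
  have hH := matLL_isHermitian hL
  have h_ker := matLL_mulVec_constFamily (C := matC E x) S
  tfae_have 1 ↔ 2 := isNondegLocalMin_iff hC hS
  tfae_have 2 ↔ 3 := by
    rw [quotHess_pos_iff hC hS]
    exact ⟨fun h Ω h1 h2 h3 => h Ω ⟨h1, h2⟩ h3, fun h Ω hΩ h3 => h Ω hΩ.1 hΩ.2 h3⟩
  tfae_have 3 ↔ 4 := by
    have h := pos_on_skewZero_iff hm hL
    exact ⟨fun h3 => h.1 fun Ω hΩ hne => h3 Ω hΩ.1 hΩ.2 hne,
      fun h4 Ω h1 h2 hne => h.2 h4 Ω ⟨h1, h2⟩ hne⟩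
  tfae_have 4 ↔ 5 := by
    constructor
    · intro h ω hω
      rw [dotProduct_matLL_mulVec]
      exact h _ (fun i => skewOf_transpose _) ((skewBlocks_ne_iff ω).2 hω)
    · intro h Ω hΩ hne
      obtain ⟨ω, rfl⟩ := exists_skewBlocks_eq hΩ
      have := h ω ((skewBlocks_ne_iff ω).1 hne)
      rwa [dotProduct_matLL_mulVec] at this
  tfae_have 5 ↔ 6 := by
    rw [← card_lowerPos]
    exact pos_iff_posSemidef_and_rank hm hH h_ker
  tfae_have 6 ↔ 7 := by
    simp only [← card_lowerPos]
    rw [posSemidef_and_rank_iff_eigenvalue_pos hm hH h_ker]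
    exact ⟨fun h => ⟨hH, h⟩, fun ⟨_, h⟩ => h⟩
  tfae_finish
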